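/- Let $R$ be an associative unital ring with center $Z(R)$. For $\phi\in\operatorname{Aut}(R)$ and $z\in Z(R)$, let $H(R,\phi,z)$ be the ring generated over $R$ by $x,y$ subject to $$yx=z,\qquad xy=\phi^{-1}(z),\qquad xr=\phi^{-1}(r)x,\qquad yr=\phi(r)y\qquad(r\in R),$$ and let $\mathcal{O}(H(R,\phi,z))$ be the full subcategory of left $H(R,\phi,z)$-modules on which $x$ acts locally nilpotently (every element is annihilated by some power of $x$). For a module $M$ let $M^{z^\infty}$ be the set of elements annihilated by some power of $z$. Let $R_\phi[y]$ denote the twisted polynomial ring with $yr=\phi(r)y$, i.e. the subring of $H(R,\phi,z)$ generated by $R$ and $y$. **Theorem.** Let $b\in Z(R)$ be nilpotent, let $l\ge 1$ be an integer, and let $z\in Z(R)$ and $\phi\in\operatorname{Aut}(R)$ be such that $$\phi^l(z)-z\in bR,\qquad (z,\phi^i(z))=Z(R)\quad\text{for }1\le i\le l-1,$$ where $(z,\phi^i(z))$ is the ideal of $Z(R)$ generated by $z$ and $\phi^i(z)$. Then the functor $$F:\mathcal{O}(H(R,\phi,z))\to\mathcal{O}(H(R,\phi^l,z)),\qquad F(M)=M^{z^\infty},$$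 is an equivalence of categories. Here $F$ sends a homomorphism to its restriction, and $H(R,\phi^l,z)$ acts on $M^{z^\infty}$ as follows: $R$ acts as on $M$, the generator $y$ acts as $y^l$, and the generator $x$ acts as $m\mapsto x^l\,\Phi^{-1}m$, where $\Phi=\phi(z)\phi^2(z)\cdots\phi^{l-1}(z)$, which acts bijectively on $M^{z^\infty}$. Moreover, for every $M\in\mathcal{O}(H(R,\phi,z))$ there is $N\in\mathcal{O}(H(R,\phi^l,z))$ such that $M$, viewed as an $R_\phi[y]$-module, is isomorphic to $R_\phi[y]_{Fr}\otimes_{R_{\phi^l}[y]}N$, where $R_\phi[y]$ is a right $R_{\phi^l}[y]$-module through the $l$-th "Frobenius" homomorphism $Fr:R_{\phi^l}[y]\to R_\phi[y]$, $Fr(y)=y^l$, $Fr(r)=r$ for $r\in R$. -/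

import Mathlib

open CategoryTheory
open scoped TensorProduct

universe u v

noncomputable section

/-! ### Generalized Weyl algebras -/

section GWA

variable {R : Type u} [Ring R]

/-- Generators of a generalized Weyl algebra over `R`: the elements of `R`, and `x`, `y`. -/
inductive GWAGen (R : Type u) : Type u
  | coeff : R → GWAGen R
  | x : GWAGen R
  | y : GWAGen R

/-- The free ring on the elements of `R` and two further letters. -/
abbrev GWAFree (R : Type u) : Type u := FreeAlgebra ℤ (GWAGen R)

/-- The letter attached to an element of `R`. -/
def GWAFree.c (r : R) : GWAFree R := FreeAlgebra.ι ℤ (GWAGen.coeff r)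

/-- The letter `x`. -/
def GWAFree.x (R : Type u) : GWAFree R := FreeAlgebra.ι ℤ GWAGen.x

/-- The letter `y`. -/
def GWAFree.y (R : Type u) : GWAFree R := FreeAlgebra.ι ℤ GWAGen.y

/-- The relations of `H(R, φ, z)`: the first three say that `R` maps to the quotient by a ring
homomorphism, the others are `yx = z`, `xy = φ⁻¹(z)`, `xr = φ⁻¹(r)x` and `yr = φ(r)y`. -/
inductive GWARel (φ : RingAut R) (z : R) : GWAFree R → GWAFree R → Prop
  | one : GWARel φ z (GWAFree.c 1) 1
  | add (r s : R) : GWARel φ z (GWAFree.c (r + s)) (GWAFree.c r + GWAFree.c s)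
  | mul (r s : R) : GWARel φ z (GWAFree.c (r * s)) (GWAFree.c r * GWAFree.c s)
  | yx : GWARel φ z (GWAFree.y R * GWAFree.x R) (GWAFree.c z)
  | xy : GWARel φ z (GWAFree.x R * GWAFree.y R) (GWAFree.c (φ⁻¹ z))
  | xr (r : R) : GWARel φ z (GWAFree.x R * GWAFree.c r) (GWAFree.c (φ⁻¹ r) * GWAFree.x R)
  | yr (r : R) : GWARel φ z (GWAFree.y R * GWAFree.c r) (GWAFree.c (φ r) * GWAFree.y R)

/-- The generalized Weyl algebra `H(R, φ, z)`: the ring generated over `R` by `x` and `y` subject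
to `yx = z`, `xy = φ⁻¹(z)`, `xr = φ⁻¹(r)x`, `yr = φ(r)y`. -/
def GWA (φ : RingAut R) (z : R) : Type u := RingQuot (GWARel φ z)

instance (φ : RingAut R) (z : R) : Ring (GWA φ z) := inferInstanceAs (Ring (RingQuot _))

namespace GWA

variable (φ : RingAut R) (z : R)

/-- The quotient map from the free ring. -/
def mk : GWAFree R →+* GWA φ z := RingQuot.mkRingHom (GWARel φ z)

/-- The structure map `R → H(R, φ, z)`. -/
def C : R →+* GWA φ z where
  toFun r := mk φ z (GWAFree.c r)
  map_one' := (RingQuot.mkRingHom_rel GWARel.one).trans (map_one _)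
  map_mul' r s := (RingQuot.mkRingHom_rel (GWARel.mul r s)).trans (map_mul _ _ _)
  map_add' r s := (RingQuot.mkRingHom_rel (GWARel.add r s)).trans (map_add _ _ _)
  map_zero' := by
    have h : mk φ z (GWAFree.c (0 + 0)) = _ :=
      (RingQuot.mkRingHom_rel (GWARel.add (φ := φ) (z := z) 0 0)).trans (map_add _ _ _)
    rw [add_zero] at h
    exact left_eq_add.mp h

/-- The generator `x` of `H(R, φ, z)`. -/
def x : GWA φ z := mk φ z (GWAFree.x R)

/-- The generator `y` of `H(R, φ, z)`. -/
def y : GWA φ z := mk φ z (GWAFree.y R)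

theorem y_mul_x : y φ z * x φ z = C φ z z :=
  (map_mul _ _ _).symm.trans (RingQuot.mkRingHom_rel GWARel.yx)

theorem x_mul_y : x φ z * y φ z = C φ z (φ⁻¹ z) :=
  (map_mul _ _ _).symm.trans (RingQuot.mkRingHom_rel GWARel.xy)

theorem x_mul_C (r : R) : x φ z * C φ z r = C φ z (φ⁻¹ r) * x φ z :=
  (map_mul _ _ _).symm.trans ((RingQuot.mkRingHom_rel (GWARel.xr r)).trans (map_mul _ _ _))

theorem y_mul_C (r : R) : y φ z * C φ z r = C φ z (φ r) * y φ z :=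
  (map_mul _ _ _).symm.trans ((RingQuot.mkRingHom_rel (GWARel.yr r)).trans (map_mul _ _ _))

theorem x_pow_mul_C (n : ℕ) (r : R) :
    x φ z ^ n * C φ z r = C φ z ((φ ^ n)⁻¹ r) * x φ z ^ n := by
  induction n generalizing r with
  | zero => simp
  | succ n ih =>
    rw [pow_succ, mul_assoc, x_mul_C, ← mul_assoc, ih, mul_assoc, pow_succ' φ, mul_inv_rev]
    rfl

theorem y_pow_mul_C (n : ℕ) (r : R) :
    y φ z ^ n * C φ z r = C φ z ((φ ^ n) r) * y φ z ^ n := by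
  induction n generalizing r with
  | zero => simp
  | succ n ih =>
    rw [pow_succ, mul_assoc, y_mul_C, ← mul_assoc, ih, mul_assoc, pow_succ φ]
    rfl

variable {φ z}

theorem induction {P : GWA φ z → Prop} (hC : ∀ r, P (C φ z r)) (hx : P (x φ z)) (hy : P (y φ z))
    (hadd : ∀ a b, P a → P b → P (a + b)) (hmul : ∀ a b, P a → P b → P (a * b))
    (a : GWA φ z) : P a := by
  obtain ⟨a, rfl⟩ := RingQuot.mkRingHom_surjective (GWARel φ z) a
  change P (mk φ z a)
  induction a using FreeAlgebra.induction with
  | grade0 n =>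
    have := hC (n : R)
    rwa [map_intCast, ← map_intCast (mk φ z)] at this
  | grade1 g =>
    cases g with
    | coeff r => exact hC r
    | x => exact hx
    | y => exact hy
  | mul a b ha hb => rw [map_mul]; exact hmul _ _ ha hb
  | add a b ha hb => rw [map_add]; exact hadd _ _ ha hb

/-- The images of the generators under the map of `GWA.lift`. -/
def liftGen {A : Type*} (f : R → A) (X Y : A) : GWAGen R → A
  | .coeff r => f r
  | .x => X
  | .y => Y

/-- The universal property of `H(R, φ, z)`. -/
def lift {A : Type*} [Ring A] (f : R →+* A) (X Y : A) (hyx : Y * X = f z)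
    (hxy : X * Y = f (φ⁻¹ z)) (hx : ∀ r, X * f r = f (φ⁻¹ r) * X)
    (hy : ∀ r, Y * f r = f (φ r) * Y) : GWA φ z →+* A :=
  RingQuot.lift ⟨(FreeAlgebra.lift ℤ (liftGen f X Y) : GWAFree R →+* A), by
    intro a b h
    cases h <;> simp [GWAFree.c, GWAFree.x, GWAFree.y, liftGen, *]⟩

section lift

variable {A : Type*} [Ring A] (f : R →+* A) (X Y : A) (hyx : Y * X = f z)
    (hxy : X * Y = f (φ⁻¹ z)) (hx : ∀ r, X * f r = f (φ⁻¹ r) * X)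
    (hy : ∀ r, Y * f r = f (φ r) * Y)

@[simp] theorem lift_C (r : R) : lift f X Y hyx hxy hx hy (C φ z r) = f r :=
  (RingQuot.lift_mkRingHom_apply _ _ _).trans (by simp [GWAFree.c, liftGen])

@[simp] theorem lift_x : lift f X Y hyx hxy hx hy (x φ z) = X :=
  (RingQuot.lift_mkRingHom_apply _ _ _).trans (by simp [GWAFree.x, liftGen])

@[simp] theorem lift_y : lift f X Y hyx hxy hx hy (y φ z) = Y :=
  (RingQuot.lift_mkRingHom_apply _ _ _).trans (by simp [GWAFree.y, liftGen])

end lift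

end GWA

/-! ### Category `𝒪` -/

/-- The left `H(R, φ, z)`-modules on which `x` acts locally nilpotently. -/
def isLocallyXNilpotent (φ : RingAut R) (z : R) : ObjectProperty (ModuleCat.{v} (GWA φ z)) :=
  fun M => ∀ m : M, ∃ n : ℕ, GWA.x φ z ^ n • m = 0

/-- The category `𝒪(H(R, φ, z))`, a full subcategory of the category of left modules. -/
abbrev CategoryO (φ : RingAut R) (z : R) := (isLocallyXNilpotent.{u, v} φ z).FullSubcategory

/-! ### Twisted polynomials, and extension of scalars over noncommutative rings -/

/-- A copy of `R` on which the monoid `ℕ` acts through the powers of `φ`. -/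
def Twist (_φ : RingAut R) : Type u := R

instance (φ : RingAut R) : Ring (Twist φ) := inferInstanceAs (Ring R)

instance (φ : RingAut R) : MulSemiringAction (Multiplicative ℕ) (Twist φ) where
  smul n r := (φ ^ n.toAdd) (r : R)
  one_smul _ := rfl
  mul_smul m n r := congrArg (fun ψ : RingAut R => ψ r) (pow_add φ m.toAdd n.toAdd)
  smul_zero n := map_zero (φ ^ n.toAdd)
  smul_add n := map_add (φ ^ n.toAdd)
  smul_one n := map_one (φ ^ n.toAdd)
  smul_mul n := map_mul (φ ^ n.toAdd)

/-- The twisted polynomial ring `R[y]`, with elements `∑ rᵢ yⁱ` and multiplication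
`y r = φ(r) y`. -/
abbrev TwistedPoly (φ : RingAut R) : Type u := SkewPolynomial (Twist φ)

namespace TwistedPoly

/-- The inclusion `R → R[y]`. -/
def C (φ : RingAut R) : R →+* TwistedPoly φ := SkewPolynomial.CRingHom (R := Twist φ)

/-- The variable `y` of `R[y]`. -/
def y (φ : RingAut R) : TwistedPoly φ := SkewPolynomial.X

theorem pow_mul_comm {φ : RingAut R} {A : Type*} [Ring A] (f : R →+* A) (Y : A)
    (hY : ∀ r, Y * f r = f (φ r) * Y) (k : ℕ) (r : R) :
    f ((φ ^ k) r) * Y ^ k = Y ^ k * f r := by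
  induction k generalizing r with
  | zero => simp
  | succ k ih =>
    rw [pow_succ Y, mul_assoc (Y ^ k), hY, ← mul_assoc (Y ^ k), ← ih, mul_assoc, pow_succ φ]
    rfl

/-- The ring homomorphism out of `R[y]` given by its restriction to `R` and the image of `y`. -/
def lift {φ : RingAut R} {A : Type*} [Ring A] (f : R →+* A) (Y : A)
    (hY : ∀ r, Y * f r = f (φ r) * Y) : TwistedPoly φ →+* A :=
  SkewMonoidAlgebra.liftNCRingHom (k := Twist φ) (show Twist φ →+* A from f) (powersHom A Y)
    fun {r n} => pow_mul_comm f Y hY n.toAdd r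

section lift

variable {φ : RingAut R} {A : Type*} [Ring A] (f : R →+* A) (Y : A)
    (hY : ∀ r, Y * f r = f (φ r) * Y)

@[simp] theorem lift_C (r : R) : lift f Y hY (C φ r) = f r :=
  (SkewMonoidAlgebra.liftNC_single _ _ _ _).trans
    ((congrArg (f r * ·) (map_one (powersHom A Y))).trans (mul_one _))

@[simp] theorem lift_y : lift f Y hY (y φ) = Y :=
  (SkewMonoidAlgebra.liftNC_single _ _ _ _).trans
    ((congrArg₂ (· * ·) (map_one f) (pow_one Y)).trans (one_mul _))

end lift

theorem y_mul_C (φ : RingAut R) (r : R) : y φ * C φ r = C φ (φ r) * y φ := by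
  refine (SkewMonoidAlgebra.single_mul_single (k := Twist φ)).trans
    (Eq.trans ?_ (SkewMonoidAlgebra.single_mul_single (k := Twist φ)).symm)
  exact congrArg₂ SkewMonoidAlgebra.single ((mul_one _).trans (one_mul _).symm)
    ((one_mul (φ r)).trans (mul_one (φ r)).symm)

theorem y_pow_mul_C (φ : RingAut R) (n : ℕ) (r : R) :
    y φ ^ n * C φ r = C φ ((φ ^ n) r) * y φ ^ n := by
  induction n generalizing r with
  | zero => simp
  | succ n ih =>
    rw [pow_succ, mul_assoc, y_mul_C, ← mul_assoc, ih, mul_assoc, pow_succ φ]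
    rfl

/-- The map `R[y] → H(R, φ, z)` identifying the twisted polynomial ring with the subring of
`H(R, φ, z)` generated by `R` and `y`. -/
def toGWA (φ : RingAut R) (z : R) : TwistedPoly φ →+* GWA φ z :=
  lift (GWA.C φ z) (GWA.y φ z) (GWA.y_mul_C φ z)

/-- The `l`-th Frobenius `Fr`, the identity on `R` and `y ↦ y ^ l`; its source is the ring `R[y]`
twisted by `φ ^ l`. -/
def frobenius (φ : RingAut R) (l : ℕ) : TwistedPoly (φ ^ l) →+* TwistedPoly φ :=
  lift (C φ) (y φ ^ l) (y_pow_mul_C φ l)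

end TwistedPoly

end GWA

/-- For a ring homomorphism `f : A → B` of not necessarily commutative rings and a left `A`-module
`N`, the left `B`-module `B ⊗_A N`, where `B` is a right `A`-module through `f`: the quotient of
`B ⊗_ℤ N` by the relations `b f(a) ⊗ n = b ⊗ a n`. -/
abbrev ExtendScalars {A B : Type*} [Ring A] [Ring B] (f : A →+* B) (N : Type*) [AddCommGroup N]
    [Module A N] :=
  (B ⊗[ℤ] N) ⧸ Submodule.span B
    {t : B ⊗[ℤ] N | ∃ (b : B) (a : A) (n : N), t = (b * f a) ⊗ₜ[ℤ] n - b ⊗ₜ[ℤ] (a • n)}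

/-! ### The functor `M ↦ M^{z^∞}` -/

section Torsion

variable {R : Type u} [Ring R] (φ : RingAut R) (z : Subring.center R) (l : ℕ)

/-- `M^{z^∞}`: the elements of the `H(R, φ, z)`-module `M` annihilated by some power of `z`. -/
def zTorsion (M : Type v) [AddCommGroup M] [Module (GWA φ (z : R)) M] : AddSubgroup M where
  carrier := {m | ∃ n : ℕ, GWA.C φ (z : R) (z : R) ^ n • m = 0}
  zero_mem' := ⟨0, smul_zero _⟩
  add_mem' := by
    rintro a b ⟨n, hn⟩ ⟨k, hk⟩
    refine ⟨n + k, ?_⟩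
    rw [smul_add, pow_add, mul_smul _ _ b, hk, smul_zero, add_zero, ← pow_add, add_comm, pow_add,
      mul_smul, hn, smul_zero]
  neg_mem' := by
    rintro a ⟨n, hn⟩
    exact ⟨n, by rw [smul_neg, hn, neg_zero]⟩

/-- The central element `φ(z) φ²(z) ⋯ φ^{l-1}(z)`. -/
def rescaling : Subring.center R := ∏ i ∈ Finset.Ico 1 l, Subring.centerCongr (φ ^ i) z

namespace zTorsion

section algebra

variable {φ z l}

theorem y_pow_mul_x_pow (n : ℕ) : GWA.y φ (z : R) ^ n * GWA.x φ (z : R) ^ n =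
    GWA.C φ (z : R) (∏ i ∈ Finset.range n, Subring.centerCongr (φ ^ i) z : Subring.center R) := by
  induction n with
  | zero => simp
  | succ n ih =>
    rw [pow_succ, pow_succ', mul_assoc, ← mul_assoc (GWA.y φ (z : R)), GWA.y_mul_x, ← mul_assoc,
      GWA.y_pow_mul_C, mul_assoc, ih, ← map_mul, Finset.prod_range_succ, mul_comm]
    rfl

theorem x_pow_mul_y_pow (n : ℕ) : GWA.x φ (z : R) ^ n * GWA.y φ (z : R) ^ n =
    GWA.C φ (z : R) ((φ ^ n)⁻¹
      (∏ i ∈ Finset.range n, Subring.centerCongr (φ ^ i) z : Subring.center R)) := by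
  have key : ∀ n, GWA.x φ (z : R) ^ n * GWA.y φ (z : R) ^ n = GWA.C φ (z : R)
      (∏ i ∈ Finset.range n, Subring.centerCongr ((φ ^ (i + 1))⁻¹) z : Subring.center R) := by
    intro n
    induction n with
    | zero => simp
    | succ n ih =>
      rw [pow_succ, pow_succ' (GWA.y φ (z : R)), mul_assoc, ← mul_assoc (GWA.x φ (z : R)),
        GWA.x_mul_y, ← mul_assoc, GWA.x_pow_mul_C, mul_assoc, ih, ← map_mul,
        Finset.prod_range_succ, mul_comm, pow_succ' φ n, mul_inv_rev]
      rfl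
  rw [key]
  congr 1
  rw [← Finset.prod_range_reflect]
  have h : ((φ ^ n)⁻¹ (∏ i ∈ Finset.range n, Subring.centerCongr (φ ^ i) z : Subring.center R) : R)
    = ((Subring.centerCongr ((φ ^ n)⁻¹) (∏ i ∈ Finset.range n, Subring.centerCongr (φ ^ i) z) :
      Subring.center R) : R) := rfl
  rw [h, map_prod]
  congr 1
  refine Finset.prod_congr rfl fun i hi => ?_
  have hi := Finset.mem_range.mp hi
  apply Subtype.ext
  change (φ ^ (n - 1 - i + 1))⁻¹ (z : R) = ((φ ^ n)⁻¹ * φ ^ i) (z : R)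
  congr 1
  rw [eq_inv_mul_iff_mul_eq, ← div_eq_mul_inv, div_eq_iff_eq_mul, ← pow_add]
  congr 1
  omega

theorem prod_range_eq (hl : 1 ≤ l) :
    ∏ i ∈ Finset.range l, Subring.centerCongr (φ ^ i) z = z * rescaling φ z l := by
  rw [Finset.range_eq_Ico, Finset.prod_eq_prod_Ico_succ_bot hl, rescaling]
  rfl

theorem isCoprime_rescaling
    (hcop : ∀ i, 1 ≤ i → i ≤ l - 1 → Ideal.span {z, Subring.centerCongr (φ ^ i) z} = ⊤) :
    IsCoprime z (rescaling φ z l) := by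
  refine IsCoprime.prod_right fun i hi => ?_
  rw [Finset.mem_Ico] at hi
  have h := hcop i hi.1 (by omega)
  rw [Ideal.eq_top_iff_one, Ideal.mem_span_pair] at h
  exact h

theorem isNilpotent_inv (h : IsNilpotent (Subring.centerCongr (φ ^ l) z - z)) :
    IsNilpotent (Subring.centerCongr ((φ ^ l)⁻¹) z - z) := by
  have h1 := (h.map (Subring.centerCongr ((φ ^ l)⁻¹))).neg
  rw [map_sub, neg_sub] at h1
  have e : Subring.centerCongr ((φ ^ l)⁻¹) (Subring.centerCongr (φ ^ l) z) = z := by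
    apply Subtype.ext
    change ((φ ^ l)⁻¹ * φ ^ l) (z : R) = z
    rw [inv_mul_cancel, RingAut.one_apply]
  rwa [e] at h1

end algebra

variable {φ z l}
variable {M : Type v} [AddCommGroup M] [Module (GWA φ (z : R)) M]

theorem exists_pow_smul {w w' : Subring.center R} (h : IsNilpotent (w' - w)) {m : M}
    (hm : ∃ n : ℕ, GWA.C φ (z : R) (w : R) ^ n • m = 0) :
    ∃ n : ℕ, GWA.C φ (z : R) (w' : R) ^ n • m = 0 := by
  obtain ⟨t, ht⟩ := h
  obtain ⟨n, hn⟩ := hm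
  refine ⟨n + t - 1, ?_⟩
  have h1 : (w + (w' - w)) ^ (n + t - 1) ∈ Ideal.span {w ^ n} :=
    Ideal.add_pow_add_pred_mem_of_pow_mem _ (Ideal.mem_span_singleton_self _)
      (by rw [ht]; exact zero_mem _)
  obtain ⟨a, ha⟩ := Ideal.mem_span_singleton'.mp h1
  rw [add_sub_cancel] at ha
  rw [← map_pow, ← SubmonoidClass.coe_pow, ← ha, Subring.coe_mul, map_mul, mul_smul,
    SubmonoidClass.coe_pow, map_pow, hn, smul_zero]

theorem pow_smul_of_le {a : GWA φ (z : R)} {m : M} {n k : ℕ} (h : a ^ n • m = 0) (hk : n ≤ k) :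
    a ^ k • m = 0 := by
  rw [← Nat.sub_add_cancel hk, pow_add, mul_smul, h, smul_zero]

theorem C_smul_mem (r : R) {m : M} (hm : m ∈ zTorsion φ z M) :
    GWA.C φ (z : R) r • m ∈ zTorsion φ z M := by
  obtain ⟨n, hn⟩ := hm
  refine ⟨n, ?_⟩
  have h : (z : R) ^ n * r = r * (z : R) ^ n :=
    Commute.pow_left (Subring.mem_center_iff.mp z.2 r).symm n
  rw [← mul_smul, ← map_pow, ← map_mul, h, map_mul, mul_smul, map_pow, hn, smul_zero]

theorem y_pow_smul_mem (h : IsNilpotent (Subring.centerCongr (φ ^ l) z - z)) {m : M}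
    (hm : m ∈ zTorsion φ z M) : GWA.y φ (z : R) ^ l • m ∈ zTorsion φ z M := by
  obtain ⟨n, hn⟩ := exists_pow_smul (isNilpotent_inv h) hm
  refine ⟨n, ?_⟩
  have h1 := GWA.y_pow_mul_C φ (z : R) l (((φ ^ l)⁻¹ (z : R)) ^ n)
  rw [map_pow (φ ^ l), ← RingAut.mul_apply, mul_inv_cancel, RingAut.one_apply] at h1
  rw [← mul_smul, ← map_pow, ← h1, mul_smul, map_pow]
  exact (congrArg _ hn).trans (smul_zero _)

theorem x_pow_smul_mem (h : IsNilpotent (Subring.centerCongr (φ ^ l) z - z)) {m : M}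
    (hm : m ∈ zTorsion φ z M) : GWA.x φ (z : R) ^ l • m ∈ zTorsion φ z M := by
  obtain ⟨n, hn⟩ := exists_pow_smul h hm
  refine ⟨n, ?_⟩
  have h1 := GWA.x_pow_mul_C φ (z : R) l (((φ ^ l) (z : R)) ^ n)
  rw [map_pow ((φ ^ l)⁻¹), ← RingAut.mul_apply, inv_mul_cancel, RingAut.one_apply] at h1
  rw [← mul_smul, ← map_pow, ← h1, mul_smul, map_pow]
  exact (congrArg _ hn).trans (smul_zero _)

/-- `R` acts on `M^{z^∞}`. -/
def actC (φ : RingAut R) (z : Subring.center R) (M : Type v) [AddCommGroup M]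
    [Module (GWA φ (z : R)) M] : R →+* AddMonoid.End (zTorsion φ z M) where
  toFun r :=
    { toFun := fun m => ⟨GWA.C φ (z : R) r • (m : M), C_smul_mem r m.2⟩
      map_zero' := Subtype.ext (smul_zero _)
      map_add' := fun _ _ => Subtype.ext (smul_add _ _ _) }
  map_one' := AddMonoidHom.ext fun m => Subtype.ext (by
    change GWA.C φ (z : R) 1 • (m : M) = m
    rw [map_one, one_smul])
  map_zero' := AddMonoidHom.ext fun m => Subtype.ext (by
    change GWA.C φ (z : R) 0 • (m : M) = 0
    rw [map_zero, zero_smul])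
  map_mul' r s := AddMonoidHom.ext fun m => Subtype.ext (by
    change GWA.C φ (z : R) (r * s) • (m : M) = GWA.C φ (z : R) r • GWA.C φ (z : R) s • (m : M)
    rw [map_mul, mul_smul])
  map_add' r s := AddMonoidHom.ext fun m => Subtype.ext (by
    change GWA.C φ (z : R) (r + s) • (m : M) =
      GWA.C φ (z : R) r • (m : M) + GWA.C φ (z : R) s • (m : M)
    rw [map_add, add_smul])

@[simp] theorem coe_actC (r : R) (m : zTorsion φ z M) :
    (actC φ z M r m : M) = GWA.C φ (z : R) r • (m : M) := rfl

/-- The operator `y ^ l` on `M^{z^∞}`. -/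
def actY (M : Type v) [AddCommGroup M] [Module (GWA φ (z : R)) M]
    (h : IsNilpotent (Subring.centerCongr (φ ^ l) z - z)) : AddMonoid.End (zTorsion φ z M) where
  toFun m := ⟨GWA.y φ (z : R) ^ l • (m : M), y_pow_smul_mem h m.2⟩
  map_zero' := Subtype.ext (smul_zero _)
  map_add' _ _ := Subtype.ext (smul_add _ _ _)

@[simp] theorem coe_actY (h : IsNilpotent (Subring.centerCongr (φ ^ l) z - z))
    (m : zTorsion φ z M) : (actY M h m : M) = GWA.y φ (z : R) ^ l • (m : M) := rfl

/-- The operator `x ^ l` on `M^{z^∞}`. -/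
def xPow (M : Type v) [AddCommGroup M] [Module (GWA φ (z : R)) M]
    (h : IsNilpotent (Subring.centerCongr (φ ^ l) z - z)) : AddMonoid.End (zTorsion φ z M) where
  toFun m := ⟨GWA.x φ (z : R) ^ l • (m : M), x_pow_smul_mem h m.2⟩
  map_zero' := Subtype.ext (smul_zero _)
  map_add' _ _ := Subtype.ext (smul_add _ _ _)

@[simp] theorem coe_xPow (h : IsNilpotent (Subring.centerCongr (φ ^ l) z - z))
    (m : zTorsion φ z M) : (xPow M h m : M) = GWA.x φ (z : R) ^ l • (m : M) := rfl

theorem exists_inverse (hc : IsCoprime z (rescaling φ z l)) (n : ℕ) :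
    ∃ c a : Subring.center R, a * z ^ n + c * rescaling φ z l = 1 := by
  obtain ⟨a, c, h⟩ := hc.pow_left (m := n)
  exact ⟨c, a, h⟩

theorem smul_inverse {n : ℕ} {c a : Subring.center R}
    (h : a * z ^ n + c * rescaling φ z l = 1) {m : M} (hm : GWA.C φ (z : R) (z : R) ^ n • m = 0) :
    GWA.C φ (z : R) (c : R) • GWA.C φ (z : R) (rescaling φ z l : R) • m = m := by
  have h1 := congrArg (fun t : Subring.center R => GWA.C φ (z : R) (t : R) • m) h
  simp only [Subring.coe_add, Subring.coe_mul, SubmonoidClass.coe_pow, map_add, map_mul, map_pow,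
    add_smul, mul_smul, hm, smul_zero, zero_add, Subring.coe_one, map_one, one_smul] at h1
  exact h1

theorem bijective_rescaling (hc : IsCoprime z (rescaling φ z l)) :
    Function.Bijective (actC φ z M (rescaling φ z l : R)) := by
  constructor
  · rw [injective_iff_map_eq_zero]
    rintro ⟨m, n, hm⟩ h0
    obtain ⟨c, a, h⟩ := exists_inverse hc n
    apply Subtype.ext
    have h1 := congrArg Subtype.val h0
    exact (smul_inverse h hm).symm.trans ((congrArg _ h1).trans (smul_zero _))
  · rintro ⟨m, n, hm⟩
    obtain ⟨c, a, h⟩ := exists_inverse hc n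
    refine ⟨⟨GWA.C φ (z : R) (c : R) • m, C_smul_mem _ ⟨n, hm⟩⟩, Subtype.ext ?_⟩
    refine Eq.trans ?_ (smul_inverse h hm)
    change GWA.C φ (z : R) _ • GWA.C φ (z : R) _ • m = _
    rw [← mul_smul, ← mul_smul, ← map_mul, ← map_mul, ← Subring.coe_mul, ← Subring.coe_mul,
      mul_comm]

/-- The inverse of the bijective action of `φ(z) φ²(z) ⋯ φ^{l-1}(z)` on `M^{z^∞}`. -/
def rescale (M : Type v) [AddCommGroup M] [Module (GWA φ (z : R)) M]
    (hc : IsCoprime z (rescaling φ z l)) : AddMonoid.End (zTorsion φ z M) :=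
  ((AddEquiv.ofBijective (actC φ z M (rescaling φ z l : R)) (bijective_rescaling hc)).symm :
    zTorsion φ z M →+ zTorsion φ z M)

theorem actC_rescale (hc : IsCoprime z (rescaling φ z l)) (m : zTorsion φ z M) :
    actC φ z M (rescaling φ z l : R) (rescale M hc m) = m :=
  (AddEquiv.ofBijective (actC φ z M (rescaling φ z l : R))
    (bijective_rescaling hc)).apply_symm_apply m

theorem rescale_eq (hc : IsCoprime z (rescaling φ z l)) {n : ℕ} {c a : Subring.center R}
    (h : a * z ^ n + c * rescaling φ z l = 1) (m : zTorsion φ z M)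
    (hm : GWA.C φ (z : R) (z : R) ^ n • (m : M) = 0) :
    (rescale M hc m : M) = GWA.C φ (z : R) (c : R) • (m : M) := by
  have h1 : rescale M hc m = actC φ z M (c : R) m := by
    apply (bijective_rescaling (M := M) hc).1
    rw [actC_rescale]
    apply Subtype.ext
    refine (smul_inverse h hm).symm.trans ?_
    change GWA.C φ (z : R) _ • GWA.C φ (z : R) _ • (m : M) =
      GWA.C φ (z : R) _ • GWA.C φ (z : R) _ • (m : M)
    rw [← mul_smul, ← mul_smul, ← map_mul, ← map_mul, ← Subring.coe_mul, ← Subring.coe_mul,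
      mul_comm]
  rw [h1]
  rfl

theorem rescale_actC (hc : IsCoprime z (rescaling φ z l)) (r : R) (m : zTorsion φ z M) :
    rescale M hc (actC φ z M r m) = actC φ z M r (rescale M hc m) := by
  apply (bijective_rescaling (M := M) hc).1
  rw [actC_rescale]
  conv_lhs => rw [← actC_rescale hc m]
  change (actC φ z M r * actC φ z M _) _ = (actC φ z M _ * actC φ z M r) _
  rw [← map_mul, ← map_mul, Subring.mem_center_iff.mp (rescaling φ z l).2 r]

/-- The action of `H(R, φ ^ l, z)` on `M^{z^∞}`: `R` acts as it does on `M`, the generator `y` acts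
as `y ^ l`, and `x` acts as `x ^ l` composed with the inverse of `φ(z) φ²(z) ⋯ φ^{l-1}(z)`, so that
`yx` acts as `z`. -/
def action (M : Type v) [AddCommGroup M] [Module (GWA φ (z : R)) M] (hl : 1 ≤ l)
    (h : IsNilpotent (Subring.centerCongr (φ ^ l) z - z))
    (hc : IsCoprime z (rescaling φ z l)) :
    GWA (φ ^ l) (z : R) →+* AddMonoid.End (zTorsion φ z M) :=
  GWA.lift (actC φ z M) (xPow M h * rescale M hc) (actY M h)
    (by
      ext m
      change GWA.y φ (z : R) ^ l • GWA.x φ (z : R) ^ l • (rescale M hc m : M) = _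
      rw [← mul_smul, y_pow_mul_x_pow, prod_range_eq hl, Subring.coe_mul, map_mul, mul_smul]
      exact congrArg _ (congrArg Subtype.val (actC_rescale hc m)))
    (by
      ext m
      change GWA.x φ (z : R) ^ l • (rescale M hc (actY M h m) : M) =
        GWA.C φ (z : R) ((φ ^ l)⁻¹ (z : R)) • (m : M)
      obtain ⟨n, hn⟩ := (actY M h m).2
      obtain ⟨k, hk⟩ := exists_pow_smul (isNilpotent_inv h) m.2
      obtain ⟨c, a, hca⟩ := exists_inverse hc (n + k)
      rw [rescale_eq hc hca _ (pow_smul_of_le hn (by omega)), coe_actY, ← mul_smul, ← mul_smul,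
        GWA.x_pow_mul_C, mul_assoc, x_pow_mul_y_pow, prod_range_eq hl, ← map_mul, ← map_mul,
        ← Subring.coe_mul, mul_left_comm, Subring.coe_mul, map_mul, map_mul, mul_smul]
      congr 1
      have h1 := congrArg (fun t : Subring.center R =>
        GWA.C φ (z : R) ((φ ^ l)⁻¹ (t : R)) • (m : M)) hca
      have h2 : GWA.C φ (z : R) ((φ ^ l)⁻¹ (z : R)) ^ (n + k) • (m : M) = 0 :=
        pow_smul_of_le hk (by omega)
      simp only [Subring.coe_add, Subring.coe_one, map_add, map_one, one_smul, add_smul] at h1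
      rw [Subring.coe_mul, map_mul, map_mul, mul_smul, SubmonoidClass.coe_pow, map_pow, map_pow, h2,
        smul_zero, zero_add] at h1
      exact h1)
    (by
      intro r
      ext m
      change GWA.x φ (z : R) ^ l • (rescale M hc (actC φ z M r m) : M) =
        GWA.C φ (z : R) ((φ ^ l)⁻¹ r) • GWA.x φ (z : R) ^ l • (rescale M hc m : M)
      rw [rescale_actC, coe_actC, ← mul_smul, GWA.x_pow_mul_C, mul_smul])
    (by
      intro r
      ext m
      change GWA.y φ (z : R) ^ l • GWA.C φ (z : R) r • (m : M) =
        GWA.C φ (z : R) ((φ ^ l) r) • GWA.y φ (z : R) ^ l • (m : M)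
      rw [← mul_smul, GWA.y_pow_mul_C, mul_smul])

/-- `M^{z^∞}` as an `H(R, φ ^ l, z)`-module. -/
@[reducible] def module (M : Type v) [AddCommGroup M] [Module (GWA φ (z : R)) M] (hl : 1 ≤ l)
    (h : IsNilpotent (Subring.centerCongr (φ ^ l) z - z))
    (hc : IsCoprime z (rescaling φ z l)) :
    Module (GWA (φ ^ l) (z : R)) (zTorsion φ z M) :=
  Module.compHom _ (action M hl h hc)

theorem x_locally_nilpotent (hl : 1 ≤ l)
    (h : IsNilpotent (Subring.centerCongr (φ ^ l) z - z))
    (hc : IsCoprime z (rescaling φ z l))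
    (hM : ∀ m : M, ∃ n : ℕ, GWA.x φ (z : R) ^ n • m = 0) (m : zTorsion φ z M) :
    ∃ n : ℕ, action M hl h hc (GWA.x (φ ^ l) (z : R) ^ n) m = 0 := by
  have key : ∀ (n : ℕ) (m : zTorsion φ z M), GWA.x φ (z : R) ^ (l * n) • (m : M) = 0 →
      ((xPow M h * rescale M hc) ^ n) m = 0 := by
    intro n
    induction n with
    | zero =>
      intro m hm
      exact Subtype.ext (by simpa using hm)
    | succ n ih =>
      intro m hm
      rw [pow_succ]
      refine ih _ ?_
      change GWA.x φ (z : R) ^ (l * n) • GWA.x φ (z : R) ^ l • (rescale M hc m : M) = 0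
      obtain ⟨k, hk⟩ := m.2
      obtain ⟨c, a, hca⟩ := exists_inverse hc k
      rw [rescale_eq hc hca m hk, ← mul_smul, ← pow_add, ← mul_smul, GWA.x_pow_mul_C, mul_smul,
        ← mul_add_one, hm, smul_zero]
  obtain ⟨n, hn⟩ := hM m
  refine ⟨n, ?_⟩
  rw [map_pow, action, GWA.lift_x]
  exact key n m (pow_smul_of_le hn (Nat.le_mul_of_pos_left n hl))

section map

variable {N : Type v} [AddCommGroup N] [Module (GWA φ (z : R)) N]

/-- The restriction of a homomorphism `M → N` to `M^{z^∞} → N^{z^∞}`. -/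
def map (f : M →ₗ[GWA φ (z : R)] N) : zTorsion φ z M →+ zTorsion φ z N where
  toFun m := ⟨f m, m.2.imp fun n hn => by rw [← map_smul, hn, map_zero]⟩
  map_zero' := Subtype.ext (map_zero f)
  map_add' _ _ := Subtype.ext (map_add f _ _)

theorem map_action (f : M →ₗ[GWA φ (z : R)] N) (hl : 1 ≤ l)
    (h : IsNilpotent (Subring.centerCongr (φ ^ l) z - z))
    (hc : IsCoprime z (rescaling φ z l)) (a : GWA (φ ^ l) (z : R)) (m : zTorsion φ z M) :
    map f (action M hl h hc a m) = action N hl h hc a (map f m) := by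
  induction a using GWA.induction generalizing m with
  | hC r =>
    rw [action, action, GWA.lift_C, GWA.lift_C]
    exact Subtype.ext (map_smul f _ _)
  | hx =>
    rw [action, action, GWA.lift_x, GWA.lift_x]
    obtain ⟨n, hn⟩ := m.2
    obtain ⟨c, a, hca⟩ := exists_inverse hc n
    apply Subtype.ext
    change f (GWA.x φ (z : R) ^ l • (rescale M hc m : M)) =
      GWA.x φ (z : R) ^ l • (rescale N hc (map f m) : N)
    rw [map_smul, rescale_eq hc hca m hn, rescale_eq hc hca (map f m) (by
      change _ • f m = 0
      rw [← map_smul, hn, map_zero]), map_smul]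
    rfl
  | hy =>
    rw [action, action, GWA.lift_y, GWA.lift_y]
    exact Subtype.ext (map_smul f _ _)
  | hadd a b ha hb => 
    rw [map_add, map_add]
    exact (map_add (map f) _ _).trans (congrArg₂ _ (ha m) (hb m))
  | hmul a b ha hb =>
    rw [map_mul, map_mul]
    exact (ha _).trans (congrArg _ (hb m))

end map

end zTorsion

/-- The functor `F : 𝒪(H(R, φ, z)) ⥤ 𝒪(H(R, φ ^ l, z))`, `F(M) = M^{z^∞}`. -/
def torsionFunctor (hl : 1 ≤ l) (h : IsNilpotent (Subring.centerCongr (φ ^ l) z - z))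
    (hcop : ∀ i, 1 ≤ i → i ≤ l - 1 → Ideal.span {z, Subring.centerCongr (φ ^ i) z} = ⊤) :
    CategoryO.{u, v} φ (z : R) ⥤ CategoryO.{u, v} (φ ^ l) (z : R) where
  obj M :=
    { obj :=
        letI := zTorsion.module M.obj hl h (zTorsion.isCoprime_rescaling hcop)
        ModuleCat.of (GWA (φ ^ l) (z : R)) (zTorsion φ z M.obj)
      property := zTorsion.x_locally_nilpotent hl h _ M.property }
  map {M N} f :=
    letI := zTorsion.module M.obj hl h (zTorsion.isCoprime_rescaling hcop)
    letI := zTorsion.module N.obj hl h (zTorsion.isCoprime_rescaling hcop)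
    ObjectProperty.homMk (ModuleCat.ofHom
      { toFun := zTorsion.map f.hom.hom
        map_add' := map_add _
        map_smul' := zTorsion.map_action f.hom.hom hl h _ })

theorem isNilpotent_of_dvd {b : Subring.center R} (hb : IsNilpotent b)
    (hz : (b : R) ∣ (φ ^ l) (z : R) - z) : IsNilpotent (Subring.centerCongr (φ ^ l) z - z) := by
  obtain ⟨n, hn⟩ := hb
  obtain ⟨a, ha⟩ := hz
  refine ⟨n, Subtype.ext ?_⟩
  change ((φ ^ l) (z : R) - z) ^ n = 0
  have h : Commute (b : R) a := (Subring.mem_center_iff.mp b.2 a).symm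
  rw [ha, h.mul_pow, ← SubmonoidClass.coe_pow, hn, Subring.coe_zero, zero_mul]

end Torsion

end

/-!
If `xⁿ m = 0` then `y^{ln} x^{ln} m = 0`, that is, `∏_{i < ln} φⁱ(z)` kills `m`. Since `φˡ(z)` and
`z` agree modulo nilpotents, this product is, modulo nilpotents, the `n`-th power of
`∏_{i < l} φⁱ(z)`, a power of which therefore kills `m`. The factors `φⁱ(z)`, `i < l`, are pairwise
coprime, so `M` is the direct sum of its `φⁱ(z)`-power torsion parts. As `xⁱ yⁱ` acts invertibly on
`M^{z^∞}` and `yⁱ xⁱ` on the `i`-th part, `yⁱ` maps `M^{z^∞}` isomorphically onto the `i`-th part.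
Hence `M = ⊕_{i < l} yⁱ M^{z^∞}` is induced from `M^{z^∞}`, and induction is inverse to `F`.
-/

noncomputable section

section Coprime

variable {S A M : Type*} [CommRing S] [Ring A] [AddCommGroup M] [Module A M] (f : S →+* A)

theorem isCoprime_of_span_pair_eq_top {s t : S} (h : Ideal.span {s, t} = ⊤) : IsCoprime s t := by
  rwa [Ideal.eq_top_iff_one, Ideal.mem_span_pair] at h

theorem eq_zero_of_isCoprime_of_smul_eq_zero {s t : S} (hst : IsCoprime s t) {m : M}
    (hs : f s • m = 0) (ht : f t • m = 0) : m = 0 := by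
  obtain ⟨a, b, hab⟩ := hst
  rw [← one_smul A m, ← map_one f, ← hab, map_add, map_mul, map_mul, add_smul, mul_smul, mul_smul,
    hs, ht, smul_zero, smul_zero, add_zero]

variable {ι : Type*} [Fintype ι] {s : ι → S}

theorem eq_zero_of_sum_eq_zero_of_pairwise_isCoprime (hs : Pairwise (Function.onFun IsCoprime s))
    {m : ι → M} (hm : ∀ i, f (s i) • m i = 0) (hsum : ∑ i, m i = 0) (i : ι) : m i = 0 := by
  let := Module.compHom M f
  have hind : iSupIndep fun i => Submodule.torsionBy S M (s i) :=
    iSupIndep_iff_supIndep_univ.mpr (Submodule.supIndep_torsionBy fun i _ j _ hij => hs hij)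
  exact (iSupIndep_iff_finsetSum_eq_zero_imp_eq_zero _).mp hind Finset.univ m
    (fun i _ => hm i) hsum i (Finset.mem_univ i)

theorem exists_sum_eq_of_prod_smul_eq_zero (hs : Pairwise (Function.onFun IsCoprime s)) {m : M}
    (hm : f (∏ i, s i) • m = 0) : ∃ n : ι → M, (∀ i, f (s i) • n i = 0) ∧ ∑ i, n i = m := by
  let := Module.compHom M f
  have hsup : m ∈ ⨆ i ∈ Finset.univ, Submodule.torsionBy S M (s i) := by
    rw [Submodule.iSup_torsionBy_eq_torsionBy_prod fun i _ j _ hij => hs hij]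
    exact hm
  obtain ⟨n, hn⟩ := (Submodule.mem_iSup_finset_iff_exists_sum _ _).mp hsup
  exact ⟨fun i => n i, fun i => (n i).2, hn⟩

end Coprime

theorem prod_range_mul_of_periodic {S : Type*} [CommMonoid S] {g : ℕ → S} {l : ℕ}
    (hg : Function.Periodic g l) (n : ℕ) :
    ∏ i ∈ Finset.range (l * n), g i = (∏ i ∈ Finset.range l, g i) ^ n := by
  induction n with
  | zero => simp
  | succ n ih =>
    have hshift (i : ℕ) : g (l * n + i) = g i := by
      rw [add_comm, mul_comm, ← smul_eq_mul]
      exact hg.nsmul n i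
    rw [Nat.mul_succ, Finset.prod_range_add, ih, pow_succ]
    simp only [hshift]

section Center

variable {R : Type u} [Ring R] {φ : RingAut R} {z : Subring.center R} {k l : ℕ}

theorem ringAut_inv_pow_succ_apply (φ : RingAut R) (n : ℕ) (r : R) :
    (φ ^ (n + 1))⁻¹ r = (φ ^ n)⁻¹ (φ⁻¹ r) := by
  rw [pow_succ', mul_inv_rev, RingAut.mul_apply]

theorem ringAut_inv_pow_succ_apply_apply (φ : RingAut R) (n : ℕ) (r : R) :
    (φ ^ (n + 1))⁻¹ (φ r) = (φ ^ n)⁻¹ r := by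
  rw [ringAut_inv_pow_succ_apply]
  exact congrArg _ (φ.symm_apply_apply r)

theorem ringAut_pow_succ_apply_inv_pow_apply (φ : RingAut R) (n : ℕ) (r : R) :
    (φ ^ (n + 1)) ((φ ^ n)⁻¹ r) = φ r := by
  rw [pow_succ', RingAut.mul_apply]
  exact congrArg φ ((φ ^ n).apply_symm_apply r)

theorem centerCongr_mul_apply (φ ψ : RingAut R) (w : Subring.center R) :
    Subring.centerCongr (φ * ψ) w = Subring.centerCongr φ (Subring.centerCongr ψ w) := rfl

section Coprime

variable (hcop : ∀ i, 1 ≤ i → i ≤ k → IsCoprime z (Subring.centerCongr (φ ^ i) z))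
include hcop

theorem isCoprime_centerCongr_pow {i j : ℕ} (hij : i < j) (hj : j ≤ k) :
    IsCoprime (Subring.centerCongr (φ ^ i) z) (Subring.centerCongr (φ ^ j) z) := by
  have h := (hcop (j - i) (by omega) (by omega)).map
    (Subring.centerCongr (φ ^ i) : Subring.center R →+* Subring.center R)
  rwa [RingHom.coe_coe, ← centerCongr_mul_apply, ← pow_add, Nat.add_sub_cancel' hij.le] at h

theorem pairwise_isCoprime_centerCongr_pow (n : ℕ) :
    Pairwise (Function.onFun IsCoprime
      fun i : Fin (k + 1) => Subring.centerCongr (φ ^ (i : ℕ)) z ^ n) := by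
  intro i j hij
  rcases lt_or_gt_of_ne hij with h | h
  · exact (isCoprime_centerCongr_pow hcop h j.is_le).pow
  · exact (isCoprime_centerCongr_pow hcop h i.is_le).symm.pow

theorem isCoprime_centerCongr_prod_range {i : ℕ} (hi : i ≤ k) :
    IsCoprime (Subring.centerCongr (φ ^ i) z)
      (∏ j ∈ Finset.range i, Subring.centerCongr (φ ^ j) z) :=
  IsCoprime.prod_right fun _ hj =>
    (isCoprime_centerCongr_pow hcop (Finset.mem_range.mp hj) hi).symm

theorem isCoprime_centerCongr_inv_prod_range {i : ℕ} (hi : i ≤ k) :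
    IsCoprime z (Subring.centerCongr (φ ^ i)⁻¹
      (∏ j ∈ Finset.range i, Subring.centerCongr (φ ^ j) z)) := by
  have h := (isCoprime_centerCongr_prod_range hcop hi).map
    (Subring.centerCongr (φ ^ i)⁻¹ : Subring.center R →+* Subring.center R)
  rwa [RingHom.coe_coe, ← centerCongr_mul_apply, inv_mul_cancel] at h

theorem isCoprime_centerCongr_inv_pow {i : ℕ} (h1 : 1 ≤ i) (hi : i ≤ k) :
    IsCoprime z (Subring.centerCongr (φ ^ i)⁻¹ z) := by
  have h := (hcop i h1 hi).symm.map
    (Subring.centerCongr (φ ^ i)⁻¹ : Subring.center R →+* Subring.center R)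
  rwa [RingHom.coe_coe, ← centerCongr_mul_apply, inv_mul_cancel] at h

end Coprime

theorem rescaling_succ :
    rescaling φ z (k + 1) =
      Subring.centerCongr φ (∏ i ∈ Finset.range k, Subring.centerCongr (φ ^ i) z) := by
  rw [rescaling, Finset.prod_Ico_eq_prod_range, map_prod]
  refine Finset.prod_congr (by rw [Nat.add_sub_cancel]) fun i _ => ?_
  rw [add_comm, pow_succ', centerCongr_mul_apply]

theorem isNilpotent_prod_range_pow_sub
    (h : IsNilpotent (Subring.centerCongr (φ ^ l) z - z)) (n : ℕ) :
    IsNilpotent ((∏ i ∈ Finset.range l, Subring.centerCongr (φ ^ i) z) ^ n -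
      ∏ i ∈ Finset.range (l * n), Subring.centerCongr (φ ^ i) z) := by
  let π := Ideal.Quotient.mk (nilradical (Subring.center R))
  have hperiodic : Function.Periodic (fun i : ℕ => π (Subring.centerCongr (φ ^ i) z)) l := by
    intro i
    refine Ideal.Quotient.eq.mpr (mem_nilradical.mpr ?_)
    rw [pow_add, centerCongr_mul_apply, ← map_sub]
    exact h.map _
  refine mem_nilradical.mp (Ideal.Quotient.eq.mp ?_)
  rw [map_pow, map_prod, map_prod]
  exact (prod_range_mul_of_periodic hperiodic n).symm

end Center

namespace GWA

variable {R : Type u} [Ring R]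

/-- The restriction of `R → H(R, φ, z)` to the centre of `R`. As a ring homomorphism out of a
commutative ring, it makes the Chinese remainder theorem available for `H(R, φ, z)`-modules. -/
def ofCenter (φ : RingAut R) (z : R) : Subring.center R →+* GWA φ z :=
  (C φ z).comp (Subring.center R).subtype

theorem ofCenter_pow (φ : RingAut R) (z : R) (w : Subring.center R) (n : ℕ) :
    ofCenter φ z (w ^ n) = C φ z w ^ n := map_pow (ofCenter φ z) w n

theorem y_pow_mul_ofCenter (φ : RingAut R) (z : R) (n : ℕ) (w : Subring.center R) :
    y φ z ^ n * ofCenter φ z w = ofCenter φ z (Subring.centerCongr (φ ^ n) w) * y φ z ^ n :=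
  y_pow_mul_C φ z n w

theorem ofCenter_mul_x_pow (φ : RingAut R) (z : R) (n : ℕ) (w : Subring.center R) :
    ofCenter φ z w * x φ z ^ n = x φ z ^ n * ofCenter φ z (Subring.centerCongr (φ ^ n) w) := by
  refine Eq.trans ?_ (x_pow_mul_C φ z n (Subring.centerCongr (φ ^ n) w)).symm
  exact congrArg (C φ z · * _) ((φ ^ n).symm_apply_apply w).symm

end GWA

/-- The elements of an `H(R, φ, z)`-module annihilated by some power of `x`: the largest submodule
lying in the category `𝒪`. -/
def xTorsion {R : Type u} [Ring R] (φ : RingAut R) (z : R) (M : Type*) [AddCommGroup M]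
    [Module (GWA φ z) M] : Submodule (GWA φ z) M where
  carrier := {m | ∃ n : ℕ, GWA.x φ z ^ n • m = 0}
  zero_mem' := ⟨0, smul_zero _⟩
  add_mem' := by
    rintro a b ⟨n, hn⟩ ⟨k, hk⟩
    refine ⟨n + k, ?_⟩
    rw [smul_add, pow_add, mul_smul _ _ b, hk, smul_zero, add_zero, ← pow_add, add_comm, pow_add,
      mul_smul, hn, smul_zero]
  smul_mem' a := by
    induction a using GWA.induction with
    | hC r =>
      rintro m ⟨n, hn⟩
      exact ⟨n, by rw [← mul_smul, GWA.x_pow_mul_C, mul_smul, hn, smul_zero]⟩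
    | hx =>
      rintro m ⟨n, hn⟩
      exact ⟨n, by rw [← mul_smul, ← pow_succ, pow_succ', mul_smul, hn, smul_zero]⟩
    | hy =>
      rintro m ⟨n, hn⟩
      exact ⟨n + 1, by rw [← mul_smul, pow_succ, mul_assoc, GWA.x_mul_y, GWA.x_pow_mul_C, mul_smul,
        hn, smul_zero]⟩
    | hadd a b ha hb =>
      rintro m ⟨n, hn⟩
      obtain ⟨s, hs⟩ := ha ⟨n, hn⟩
      obtain ⟨t, ht⟩ := hb ⟨n, hn⟩
      refine ⟨s + t, ?_⟩
      rw [add_smul, smul_add, pow_add, mul_smul _ _ (b • m), ht, smul_zero, add_zero, ← pow_add,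
        add_comm, pow_add, mul_smul, hs, smul_zero]
    | hmul a b ha hb =>
      intro m hm
      rw [mul_smul]
      exact ha (hb hm)

theorem mem_xTorsion_of_x_smul_mem {R : Type u} [Ring R] {φ : RingAut R} {z : R} {M : Type*}
    [AddCommGroup M] [Module (GWA φ z) M] {m : M} (hm : GWA.x φ z • m ∈ xTorsion φ z M) :
    m ∈ xTorsion φ z M := by
  obtain ⟨n, hn⟩ := hm
  exact ⟨n + 1, by rw [pow_succ, mul_smul, hn]⟩

namespace zTorsion

variable {R : Type u} [Ring R] {φ : RingAut R} {z : Subring.center R} {k l : ℕ} {M : Type v}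
  [AddCommGroup M] [Module (GWA φ (z : R)) M]

theorem exists_prod_pow_smul_eq_zero (hl : 1 ≤ l)
    (h : IsNilpotent (Subring.centerCongr (φ ^ l) z - z)) {m : M}
    (hm : m ∈ xTorsion φ (z : R) M) :
    ∃ t : ℕ, GWA.C φ (z : R)
      (∏ i ∈ Finset.range l, Subring.centerCongr (φ ^ i) z : Subring.center R) ^ t • m = 0 := by
  obtain ⟨n, hn⟩ := hm
  have hprod : GWA.C φ (z : R)
      (∏ i ∈ Finset.range (l * n), Subring.centerCongr (φ ^ i) z : Subring.center R) • m = 0 := by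
    rw [← y_pow_mul_x_pow, mul_smul, pow_smul_of_le hn (Nat.le_mul_of_pos_left n hl), smul_zero]
  obtain ⟨t, ht⟩ := exists_pow_smul (isNilpotent_prod_range_pow_sub h n)
    ⟨1, by rwa [pow_one]⟩
  refine ⟨n * t, ?_⟩
  rwa [SubmonoidClass.coe_pow, map_pow, ← pow_mul] at ht

theorem mem_of_mem_xTorsion (h : IsNilpotent (Subring.centerCongr φ z - z)) {m : M}
    (hm : m ∈ xTorsion φ (z : R) M) : m ∈ zTorsion φ z M := by
  obtain ⟨t, ht⟩ := exists_prod_pow_smul_eq_zero (l := 1) le_rfl (by rwa [pow_one]) hm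
  rw [Finset.prod_range_one] at ht
  exact ⟨t, ht⟩

section Coprime

variable (hcop : ∀ i, 1 ≤ i → i ≤ k → IsCoprime z (Subring.centerCongr (φ ^ i) z))
include hcop

theorem eq_zero_of_y_pow_smul_eq_zero {i : ℕ} (hi : i ≤ k) {m : M} (hm : m ∈ zTorsion φ z M)
    (h : GWA.y φ (z : R) ^ i • m = 0) : m = 0 := by
  obtain ⟨n, hn⟩ := hm
  refine eq_zero_of_isCoprime_of_smul_eq_zero (GWA.ofCenter φ (z : R))
    ((isCoprime_centerCongr_inv_prod_range hcop hi).pow_left (m := n)) ?_ ?_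
  · rw [GWA.ofCenter_pow, hn]
  · have hxy := congrArg (GWA.x φ (z : R) ^ i • ·) h
    simp only [smul_zero] at hxy
    rwa [← mul_smul, x_pow_mul_y_pow] at hxy

theorem exists_mem_y_pow_smul_eq {i n : ℕ} (hi : i ≤ k) {m : M}
    (hm : GWA.ofCenter φ (z : R) (Subring.centerCongr (φ ^ i) z ^ n) • m = 0) :
    ∃ w ∈ zTorsion φ z M, GWA.y φ (z : R) ^ i • w = m := by
  obtain ⟨a, c, hac⟩ := (isCoprime_centerCongr_prod_range hcop hi).pow_left (m := n)
  refine ⟨GWA.x φ (z : R) ^ i • GWA.ofCenter φ (z : R) c • m, ⟨n, ?_⟩, ?_⟩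
  · rw [← GWA.ofCenter_pow, ← mul_smul, GWA.ofCenter_mul_x_pow, map_pow (Subring.centerCongr _),
      mul_smul, ← mul_smul (GWA.ofCenter _ _ _), ← map_mul, mul_comm, map_mul, mul_smul, hm,
      smul_zero, smul_zero]
  · calc GWA.y φ (z : R) ^ i • GWA.x φ (z : R) ^ i • GWA.ofCenter φ (z : R) c • m
        = GWA.ofCenter φ (z : R) (∏ j ∈ Finset.range i, Subring.centerCongr (φ ^ j) z) •
            GWA.ofCenter φ (z : R) c • m := by
          rw [← mul_smul, y_pow_mul_x_pow]
          rfl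
      _ = GWA.ofCenter φ (z : R) (a * Subring.centerCongr (φ ^ i) z ^ n +
            c * ∏ j ∈ Finset.range i, Subring.centerCongr (φ ^ j) z) • m := by
          rw [map_add, add_smul, map_mul, mul_smul, hm, smul_zero, zero_add, mul_comm, map_mul,
            mul_smul]
      _ = m := by rw [hac, map_one, one_smul]

end Coprime

end zTorsion

section PowSum

variable {A N M : Type*} [Monoid A] [AddMonoid N] [AddCommMonoid M] [DistribMulAction A M]

/-- The map `(n₀, …, n_{l-1}) ↦ ∑ aⁱ ι(nᵢ)`. For `a = y` and `ι` the inclusion of `M^{z^∞}` in an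
`H(R, φ, z)`-module `M` it compares `M` with the sum of `l` copies of `M^{z^∞}`. -/
def powSum (a : A) (l : ℕ) (ι : N →+ M) : (Fin l → N) →+ M :=
  ∑ i : Fin l,
    ((DistribSMul.toAddMonoidHom M (a ^ (i : ℕ))).comp ι).comp (Pi.evalAddMonoidHom (fun _ => N) i)

theorem powSum_apply (a : A) (l : ℕ) (ι : N →+ M) (f : Fin l → N) :
    powSum a l ι f = ∑ i : Fin l, a ^ (i : ℕ) • ι (f i) :=
  AddMonoidHom.finsetSum_apply _ _ _

theorem powSum_single (a : A) {l : ℕ} (ι : N →+ M) (i : Fin l) (n : N) :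
    powSum a l ι (Pi.single i n) = a ^ (i : ℕ) • ι n := by
  rw [powSum_apply, Finset.sum_eq_single_of_mem i (Finset.mem_univ i), Pi.single_eq_same]
  intro j _ hj
  rw [Pi.single_eq_of_ne hj, map_zero, smul_zero]

theorem smul_powSum_eq_powSum_cons {a : A} {k : ℕ} {ι : N →+ M} {f : Fin (k + 1) → N} {n : N}
    (hn : a ^ (k + 1) • ι (f (Fin.last k)) = ι n) :
    a • powSum a (k + 1) ι f = powSum a (k + 1) ι (Fin.cons n (Fin.init f)) := by
  rw [powSum_apply, powSum_apply, Fin.sum_univ_castSucc, Fin.sum_univ_succ, smul_add,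
    Finset.smul_sum, ← mul_smul a (a ^ _), ← pow_succ', Fin.val_last, hn, add_comm]
  simp only [Fin.cons_zero, Fin.cons_succ, Fin.val_zero, pow_zero, one_smul, Fin.val_succ,
    pow_succ', mul_smul, Fin.init, Fin.val_castSucc]

end PowSum

section Induced

variable {R : Type u} [Ring R] (φ : RingAut R) (z : Subring.center R) (k : ℕ)

/-- The module `N ⊕ yN ⊕ ⋯ ⊕ yᵏN` over `H(R, φ, z)` induced from an `H(R, φ ^ (k + 1), z)`-module
`N`. The function `f` stands for `∑ yⁱ f(i)`; `z` and `φ` are recorded in the type because the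
action depends on them. -/
def InducedModule (_φ : RingAut R) (_z : Subring.center R) (k : ℕ) (N : Type*) : Type _ :=
  Fin (k + 1) → N

namespace InducedModule

variable (N : Type*) [AddCommGroup N]

instance : AddCommGroup (InducedModule φ z k N) := inferInstanceAs (AddCommGroup (Fin (k + 1) → N))

/-- The inclusion of `N` in the induced module as the summand `yⁱ N`. -/
def single (i : Fin (k + 1)) : N →+ InducedModule φ z k N :=
  AddMonoidHom.single (fun _ => N) i

variable {φ z k N} in
theorem single_injective (i : Fin (k + 1)) : Function.Injective (single φ z k N i) :=
  Pi.single_injective (M := fun _ => N) i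

variable {φ z k N} in
theorem sum_single (f : InducedModule φ z k N) : ∑ i, single φ z k N i (f i) = f :=
  Finset.univ_sum_single f

variable [Module (GWA (φ ^ (k + 1)) (z : R)) N]

/-- The action of `R` on the induced module, `r yⁱ n = yⁱ φ⁻ⁱ(r) n`. -/
def actC : R →+* AddMonoid.End (Fin (k + 1) → N) :=
  (Module.toAddMonoidEnd (Fin (k + 1) → GWA (φ ^ (k + 1)) (z : R)) (Fin (k + 1) → N)).comp
    (RingHom.pi fun i => (GWA.C (φ ^ (k + 1)) (z : R)).comp ((φ ^ (i : ℕ))⁻¹ : R ≃+* R))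

/-- The action of `y` on the induced module, `y · yⁱ n = yⁱ⁺¹ n`, where `yᵏ⁺¹` acts on `N` as the
generator `y` of `H(R, φ ^ (k + 1), z)`. -/
def actY : AddMonoid.End (Fin (k + 1) → N) :=
  AddMonoidHom.mk'
    (fun f => Fin.cons (GWA.y (φ ^ (k + 1)) (z : R) • f (Fin.last k)) (Fin.init f))
    fun f g => by
      ext i
      cases i using Fin.cases with
      | zero => exact smul_add _ _ _
      | succ i => rfl

/-- The action of `x` on the induced module, `x · yⁱ⁺¹ n = yⁱ φ⁻ⁱ⁻¹(z) n` and
`x n = yᵏ x n`, the second `x` being the generator of `H(R, φ ^ (k + 1), z)`. -/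
def actX : AddMonoid.End (Fin (k + 1) → N) :=
  AddMonoidHom.mk'
    (fun f => Fin.snoc
      (fun i => GWA.C (φ ^ (k + 1)) (z : R) ((φ ^ (i + 1 : ℕ))⁻¹ (z : R)) • f i.succ)
      (GWA.x (φ ^ (k + 1)) (z : R) • f 0))
    fun f g => by
      ext i
      cases i using Fin.lastCases with
      | last => simp
      | cast i => simp

variable {φ z k N}

theorem actC_apply (r : R) (f : Fin (k + 1) → N) (i : Fin (k + 1)) :
    actC φ z k N r f i = GWA.C (φ ^ (k + 1)) (z : R) ((φ ^ (i : ℕ))⁻¹ r) • f i := rfl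

theorem actY_zero (f : Fin (k + 1) → N) :
    actY φ z k N f 0 = GWA.y (φ ^ (k + 1)) (z : R) • f (Fin.last k) := rfl

theorem actY_succ (f : Fin (k + 1) → N) (i : Fin k) :
    actY φ z k N f i.succ = f i.castSucc := rfl

theorem actX_eq_snoc (f : Fin (k + 1) → N) :
    actX φ z k N f = Fin.snoc (α := fun _ => N)
      (fun i => GWA.C (φ ^ (k + 1)) (z : R) ((φ ^ (i + 1 : ℕ))⁻¹ (z : R)) • f i.succ)
      (GWA.x (φ ^ (k + 1)) (z : R) • f 0) := rfl

theorem actX_last (f : Fin (k + 1) → N) :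
    actX φ z k N f (Fin.last k) = GWA.x (φ ^ (k + 1)) (z : R) • f 0 := by
  rw [actX_eq_snoc, Fin.snoc_last]

theorem actX_castSucc (f : Fin (k + 1) → N) (i : Fin k) :
    actX φ z k N f i.castSucc =
      GWA.C (φ ^ (k + 1)) (z : R) ((φ ^ (i + 1 : ℕ))⁻¹ (z : R)) • f i.succ := by
  rw [actX_eq_snoc, Fin.snoc_castSucc]

theorem actY_mul_actX : actY φ z k N * actX φ z k N = actC φ z k N z := by
  refine AddMonoidHom.ext fun f => funext fun i => ?_
  change actY φ z k N (actX φ z k N f) i = actC φ z k N z f i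
  cases i using Fin.cases with
  | zero => rw [actY_zero, actX_last, ← mul_smul, GWA.y_mul_x, actC_apply]; simp
  | succ i => rw [actY_succ, actX_castSucc, actC_apply, Fin.val_succ]

theorem actX_mul_actY : actX φ z k N * actY φ z k N = actC φ z k N (φ⁻¹ z) := by
  refine AddMonoidHom.ext fun f => funext fun i => ?_
  change actX φ z k N (actY φ z k N f) i = actC φ z k N (φ⁻¹ z) f i
  cases i using Fin.lastCases with
  | last =>
    rw [actX_last, actY_zero, ← mul_smul, GWA.x_mul_y, actC_apply, Fin.val_last,
      ringAut_inv_pow_succ_apply]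
  | cast i => rw [actX_castSucc, actY_succ, actC_apply, Fin.val_castSucc,
      ringAut_inv_pow_succ_apply]

theorem actX_mul_actC (r : R) :
    actX φ z k N * actC φ z k N r = actC φ z k N (φ⁻¹ r) * actX φ z k N := by
  refine AddMonoidHom.ext fun f => funext fun i => ?_
  change actX φ z k N (actC φ z k N r f) i = actC φ z k N _ (actX φ z k N f) i
  cases i using Fin.lastCases with
  | last =>
    rw [actX_last, actC_apply, actC_apply, actX_last, ← mul_smul, ← mul_smul, GWA.x_mul_C,
      Fin.val_last, ringAut_inv_pow_succ_apply]
    simp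
  | cast i =>
    have hz : Commute (z : R) r := (Subring.mem_center_iff.mp z.2 r).symm
    rw [actX_castSucc, actC_apply, actC_apply, actX_castSucc, Fin.val_succ, Fin.val_castSucc,
      ← ringAut_inv_pow_succ_apply, ← mul_smul, ← mul_smul, ← map_mul (GWA.C _ _),
      ← map_mul (GWA.C _ _), (hz.map _).eq]

theorem actY_mul_actC (r : R) :
    actY φ z k N * actC φ z k N r = actC φ z k N (φ r) * actY φ z k N := by
  refine AddMonoidHom.ext fun f => funext fun i => ?_
  change actY φ z k N (actC φ z k N r f) i = actC φ z k N _ (actY φ z k N f) i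
  cases i using Fin.cases with
  | zero =>
    rw [actY_zero, actC_apply, actC_apply, actY_zero, ← mul_smul, ← mul_smul, GWA.y_mul_C,
      Fin.val_last, ringAut_pow_succ_apply_inv_pow_apply]
    simp
  | succ i =>
    rw [actY_succ, actC_apply, actC_apply, actY_succ, Fin.val_succ, Fin.val_castSucc,
      ringAut_inv_pow_succ_apply_apply]

variable (φ z k N) in
/-- The action of `H(R, φ, z)` on the induced module. -/
def action : GWA φ (z : R) →+* AddMonoid.End (Fin (k + 1) → N) :=
  GWA.lift (actC φ z k N) (actX φ z k N) (actY φ z k N) actY_mul_actX actX_mul_actY actX_mul_actC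
    actY_mul_actC

theorem action_C (r : R) : action φ z k N (GWA.C φ (z : R) r) = actC φ z k N r :=
  GWA.lift_C ..

theorem action_x : action φ z k N (GWA.x φ (z : R)) = actX φ z k N :=
  GWA.lift_x ..

theorem action_y : action φ z k N (GWA.y φ (z : R)) = actY φ z k N :=
  GWA.lift_y ..

instance : Module (GWA φ (z : R)) (InducedModule φ z k N) :=
  Module.compHom (Fin (k + 1) → N) (action φ z k N)

theorem C_smul_single_zero (r : R) (n : N) :
    GWA.C φ (z : R) r • single φ z k N 0 n =
      single φ z k N 0 (GWA.C (φ ^ (k + 1)) (z : R) r • n) := by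
  change action φ z k N (GWA.C φ (z : R) r) (Pi.single 0 n) = Pi.single 0 _
  rw [action_C]
  ext i
  rcases eq_or_ne i 0 with rfl | hi
  · rfl
  · rw [actC_apply, Pi.single_eq_of_ne hi, Pi.single_eq_of_ne hi, smul_zero]

theorem y_smul_single_castSucc (i : Fin k) (n : N) :
    GWA.y φ (z : R) • single φ z k N i.castSucc n = single φ z k N i.succ n := by
  change action φ z k N (GWA.y φ (z : R)) (Pi.single i.castSucc n) = Pi.single i.succ n
  rw [action_y]
  ext j
  cases j using Fin.cases with
  | zero =>
    rw [actY_zero, Pi.single_eq_of_ne (Fin.castSucc_ne_last i).symm, smul_zero,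
      Pi.single_eq_of_ne (Fin.succ_ne_zero i).symm]
  | succ j => simp [actY_succ, Pi.single_apply]

theorem y_smul_single_last (n : N) :
    GWA.y φ (z : R) • single φ z k N (Fin.last k) n =
      single φ z k N 0 (GWA.y (φ ^ (k + 1)) (z : R) • n) := by
  change action φ z k N (GWA.y φ (z : R)) (Pi.single (Fin.last k) n) = Pi.single 0 _
  rw [action_y]
  ext j
  cases j using Fin.cases with
  | zero => rw [actY_zero, Pi.single_eq_same, Pi.single_eq_same]
  | succ j =>
    rw [actY_succ, Pi.single_eq_of_ne (Fin.castSucc_ne_last j),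
      Pi.single_eq_of_ne (Fin.succ_ne_zero j)]

theorem x_smul_single_zero (n : N) :
    GWA.x φ (z : R) • single φ z k N 0 n =
      single φ z k N (Fin.last k) (GWA.x (φ ^ (k + 1)) (z : R) • n) := by
  change action φ z k N (GWA.x φ (z : R)) (Pi.single 0 n) = Pi.single (Fin.last k) _
  rw [action_x]
  ext j
  cases j using Fin.lastCases with
  | last => rw [actX_last, Pi.single_eq_same, Pi.single_eq_same]
  | cast j =>
    rw [actX_castSucc, Pi.single_eq_of_ne (Fin.succ_ne_zero j), smul_zero,
      Pi.single_eq_of_ne (Fin.castSucc_ne_last j)]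

theorem y_pow_smul_single_zero (i : Fin (k + 1)) (n : N) :
    GWA.y φ (z : R) ^ (i : ℕ) • single φ z k N 0 n = single φ z k N i n := by
  induction i using Fin.induction with
  | zero => rw [Fin.val_zero, pow_zero, one_smul]
  | succ i ih =>
    rw [Fin.val_succ, pow_succ', mul_smul, ← Fin.val_castSucc, ih, y_smul_single_castSucc]

end InducedModule

end Induced

namespace GWA

variable {R : Type u} [Ring R] (φ : RingAut R) (z : R)

theorem C_mul_y_pow (n : ℕ) (r : R) : C φ z r * y φ z ^ n = y φ z ^ n * C φ z ((φ ^ n)⁻¹ r) := by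
  rw [y_pow_mul_C]
  exact congrArg (C φ z · * _) ((φ ^ n).apply_symm_apply r).symm

theorem x_mul_y_pow_succ (n : ℕ) :
    x φ z * y φ z ^ (n + 1) = y φ z ^ n * C φ z ((φ ^ (n + 1))⁻¹ z) := by
  rw [pow_succ', ← mul_assoc, x_mul_y, C_mul_y_pow, ringAut_inv_pow_succ_apply]

end GWA

section Frobenius

variable {R : Type u} [Ring R] {φ : RingAut R} {z : Subring.center R} {k : ℕ}

/-- A map `ι` from an `H(R, φ ^ (k + 1), z)`-module to an `H(R, φ, z)`-module which is `R`-linear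
and turns the action of `y` into that of `yᵏ⁺¹`. The inclusion of `M^{z^∞}` also turns the action of
`x` into that of `xᵏ⁺¹ Φ⁻¹`; multiplied by `yᵏ` this becomes the condition `map_x`, in which no
inverse occurs. -/
structure IsFrobeniusLinear (φ : RingAut R) (z : Subring.center R) (k : ℕ) {N M : Type*}
    [AddCommGroup N] [Module (GWA (φ ^ (k + 1)) (z : R)) N] [AddCommGroup M]
    [Module (GWA φ (z : R)) M] (ι : N →+ M) : Prop where
  map_C (r : R) (n : N) : ι (GWA.C (φ ^ (k + 1)) (z : R) r • n) = GWA.C φ (z : R) r • ι n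
  map_y (n : N) : ι (GWA.y (φ ^ (k + 1)) (z : R) • n) = GWA.y φ (z : R) ^ (k + 1) • ι n
  map_x (n : N) :
    GWA.y φ (z : R) ^ k • ι (GWA.x (φ ^ (k + 1)) (z : R) • n) = GWA.x φ (z : R) • ι n

namespace IsFrobeniusLinear

variable {N M : Type*} [AddCommGroup N] [Module (GWA (φ ^ (k + 1)) (z : R)) N]
  [AddCommGroup M] [Module (GWA φ (z : R)) M] {ι : N →+ M}

theorem comp {N' : Type*} [AddCommGroup N'] [Module (GWA (φ ^ (k + 1)) (z : R)) N']
    (h : IsFrobeniusLinear φ z k ι) (g : N' →ₗ[GWA (φ ^ (k + 1)) (z : R)] N) :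
    IsFrobeniusLinear φ z k (ι.comp g.toAddMonoidHom) where
  map_C r _ := (congrArg ι (map_smul g _ _)).trans (h.map_C r _)
  map_y _ := (congrArg ι (map_smul g _ _)).trans (h.map_y _)
  map_x _ := (congrArg (_ • ι ·) (map_smul g _ _)).trans (h.map_x _)

theorem powSum_actC (h : IsFrobeniusLinear φ z k ι) (r : R) (f : Fin (k + 1) → N) :
    powSum (GWA.y φ (z : R)) (k + 1) ι (InducedModule.actC φ z k N r f) =
      GWA.C φ (z : R) r • powSum (GWA.y φ (z : R)) (k + 1) ι f := by
  simp only [powSum_apply, InducedModule.actC_apply, h.map_C, Finset.smul_sum, ← mul_smul,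
    GWA.C_mul_y_pow]

theorem powSum_actY (h : IsFrobeniusLinear φ z k ι) (f : Fin (k + 1) → N) :
    powSum (GWA.y φ (z : R)) (k + 1) ι (InducedModule.actY φ z k N f) =
      GWA.y φ (z : R) • powSum (GWA.y φ (z : R)) (k + 1) ι f :=
  (smul_powSum_eq_powSum_cons (h.map_y _).symm).symm

theorem powSum_actX (h : IsFrobeniusLinear φ z k ι) (f : Fin (k + 1) → N) :
    powSum (GWA.y φ (z : R)) (k + 1) ι (InducedModule.actX φ z k N f) =
      GWA.x φ (z : R) • powSum (GWA.y φ (z : R)) (k + 1) ι f := by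
  rw [powSum_apply, powSum_apply, Fin.sum_univ_castSucc, Fin.sum_univ_succ, smul_add,
    Finset.smul_sum, add_comm]
  simp only [InducedModule.actX_last, InducedModule.actX_castSucc, Fin.val_last, Fin.val_zero,
    Fin.val_succ, Fin.val_castSucc, h.map_x, h.map_C, pow_zero, one_smul, ← mul_smul,
    GWA.x_mul_y_pow_succ]

theorem powSum_action (h : IsFrobeniusLinear φ z k ι) (a : GWA φ (z : R)) (f : Fin (k + 1) → N) :
    powSum (GWA.y φ (z : R)) (k + 1) ι (InducedModule.action φ z k N a f) =
      a • powSum (GWA.y φ (z : R)) (k + 1) ι f := by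
  induction a using GWA.induction generalizing f with
  | hC r => rw [InducedModule.action_C, h.powSum_actC]
  | hx => rw [InducedModule.action_x, h.powSum_actX]
  | hy => rw [InducedModule.action_y, h.powSum_actY]
  | hadd a b ha hb =>
    rw [map_add, add_smul, ← ha, ← hb]
    exact map_add (powSum _ _ ι) _ _
  | hmul a b ha hb =>
    rw [map_mul, mul_smul, ← hb, ← ha]
    rfl

/-- The extension of `ι` to the induced module, `∑ yⁱ f(i) ↦ ∑ yⁱ ι(f(i))`. -/
def lift (h : IsFrobeniusLinear φ z k ι) : InducedModule φ z k N →ₗ[GWA φ (z : R)] M where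
  __ := powSum (GWA.y φ (z : R)) (k + 1) ι
  map_smul' := h.powSum_action

theorem lift_single_zero (h : IsFrobeniusLinear φ z k ι) (n : N) :
    h.lift (InducedModule.single φ z k N 0 n) = ι n := by
  refine (powSum_single _ ι 0 n).trans ?_
  rw [Fin.val_zero, pow_zero, one_smul]

theorem single_zero : IsFrobeniusLinear φ z k (InducedModule.single φ z k N 0) where
  map_C r n := (InducedModule.C_smul_single_zero r n).symm
  map_y n := by
    rw [← InducedModule.y_smul_single_last, ← InducedModule.y_pow_smul_single_zero, Fin.val_last,
      ← mul_smul, pow_succ']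
  map_x n := by
    rw [InducedModule.x_smul_single_zero, ← InducedModule.y_pow_smul_single_zero (Fin.last k),
      Fin.val_last]

theorem map_smul_of_comp {N' : Type*} [AddCommGroup N'] [Module (GWA (φ ^ (k + 1)) (z : R)) N']
    {g : N' →+ N} (h : IsFrobeniusLinear φ z k ι) (hg : IsFrobeniusLinear φ z k (ι.comp g))
    (hy : ∀ n, GWA.y φ (z : R) ^ k • ι n = 0 → n = 0)
    (a : GWA (φ ^ (k + 1)) (z : R)) (n : N') : g (a • n) = a • g n := by
  have hι : Function.Injective ι := (injective_iff_map_eq_zero ι).mpr fun n hn =>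
    hy n (by rw [hn, smul_zero])
  induction a using GWA.induction generalizing n with
  | hC r => exact hι ((hg.map_C r n).trans (h.map_C r _).symm)
  | hx =>
    refine sub_eq_zero.mp (hy _ ?_)
    rw [map_sub, smul_sub, h.map_x, sub_eq_zero]
    exact hg.map_x n
  | hy => exact hι ((hg.map_y n).trans (h.map_y _).symm)
  | hadd a b ha hb => rw [add_smul, map_add, ha, hb, add_smul]
  | hmul a b ha hb => rw [mul_smul, ha, hb, mul_smul]

end IsFrobeniusLinear

end Frobenius

section Decomposition

variable {R : Type u} [Ring R] {φ : RingAut R} {z : Subring.center R} {k : ℕ}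

namespace zTorsion

variable {M : Type v} [AddCommGroup M] [Module (GWA φ (z : R)) M]

section Coprime

variable (hcop : ∀ i, 1 ≤ i → i ≤ k → IsCoprime z (Subring.centerCongr (φ ^ i) z))
include hcop

theorem powSum_subtype_injective :
    Function.Injective (powSum (GWA.y φ (z : R)) (k + 1) (zTorsion φ z M).subtype) := by
  refine (injective_iff_map_eq_zero _).mpr fun f hf => funext fun i => Subtype.ext ?_
  choose n hn using fun i => (f i).2
  have htorsion (i : Fin (k + 1)) :
      GWA.ofCenter φ (z : R) (Subring.centerCongr (φ ^ (i : ℕ)) z ^ Finset.univ.sup n) •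
        GWA.y φ (z : R) ^ (i : ℕ) • (f i : M) = 0 := by
    rw [← mul_smul, ← map_pow, ← GWA.y_pow_mul_ofCenter, mul_smul, GWA.ofCenter_pow,
      pow_smul_of_le (hn i) (Finset.le_sup (Finset.mem_univ i)), smul_zero]
  rw [powSum_apply] at hf
  exact eq_zero_of_y_pow_smul_eq_zero hcop i.is_le (f i).2
    (eq_zero_of_sum_eq_zero_of_pairwise_isCoprime (GWA.ofCenter φ (z : R))
      (pairwise_isCoprime_centerCongr_pow hcop (Finset.univ.sup n)) htorsion hf i)

theorem exists_powSum_subtype_eq (hnil : IsNilpotent (Subring.centerCongr (φ ^ (k + 1)) z - z))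
    {m : M} (hm : m ∈ xTorsion φ (z : R) M) :
    ∃ f, powSum (GWA.y φ (z : R)) (k + 1) (zTorsion φ z M).subtype f = m := by
  obtain ⟨t, ht⟩ := exists_prod_pow_smul_eq_zero (Nat.le_add_left 1 k) hnil hm
  have hprod : GWA.ofCenter φ (z : R)
      (∏ i : Fin (k + 1), Subring.centerCongr (φ ^ (i : ℕ)) z ^ t) • m = 0 := by
    rw [Finset.prod_pow, Fin.prod_univ_eq_prod_range (fun i => Subring.centerCongr (φ ^ i) z),
      GWA.ofCenter_pow, ht]
  obtain ⟨m', hm', rfl⟩ := exists_sum_eq_of_prod_smul_eq_zero _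
    (pairwise_isCoprime_centerCongr_pow hcop t) hprod
  choose w hw hwm using fun i => exists_mem_y_pow_smul_eq hcop (Fin.is_le i) (hm' i)
  refine ⟨fun i => ⟨w i, hw i⟩, ?_⟩
  rw [powSum_apply]
  exact Finset.sum_congr rfl fun i _ => hwm i

end Coprime

theorem isFrobeniusLinear_subtype (hl : 1 ≤ k + 1)
    (hnil : IsNilpotent (Subring.centerCongr (φ ^ (k + 1)) z - z))
    (hc : IsCoprime z (rescaling φ z (k + 1))) :
    letI := zTorsion.module M hl hnil hc
    IsFrobeniusLinear φ z k (zTorsion φ z M).subtype :=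
  letI := zTorsion.module M hl hnil hc
  { map_C r n := by
      change (action M hl hnil hc (GWA.C _ _ r) n : M) = _
      rw [action, GWA.lift_C]
      rfl
    map_y n := by
      change (action M hl hnil hc (GWA.y _ _) n : M) = _
      rw [action, GWA.lift_y]
      rfl
    map_x n := by
      change _ • (action M hl hnil hc (GWA.x _ _) n : M) = _
      rw [action, GWA.lift_x]
      change GWA.y φ (z : R) ^ k • GWA.x φ (z : R) ^ (k + 1) • (rescale M hc n : M) =
        GWA.x φ (z : R) • (n : M)
      have hrescale := congrArg Subtype.val (actC_rescale hc n)
      rw [coe_actC] at hrescale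
      rw [← hrescale, pow_succ, mul_smul, ← mul_smul, y_pow_mul_x_pow, rescaling_succ,
        ← mul_smul (GWA.x φ (z : R)), GWA.x_mul_C, mul_smul]
      congr 2
      exact (φ.symm_apply_apply _).symm }

end zTorsion

namespace InducedModule

variable {N : Type*} [AddCommGroup N] [Module (GWA (φ ^ (k + 1)) (z : R)) N]

theorem single_zero_mem_xTorsion {n : N} (hn : n ∈ xTorsion (φ ^ (k + 1)) (z : R) N) :
    single φ z k N 0 n ∈ xTorsion φ (z : R) (InducedModule φ z k N) := by
  obtain ⟨t, ht⟩ := hn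
  induction t generalizing n with
  | zero =>
    rw [pow_zero, one_smul] at ht
    rw [ht, map_zero]
    exact zero_mem _
  | succ t ih =>
    refine mem_xTorsion_of_x_smul_mem ?_
    rw [x_smul_single_zero, ← y_pow_smul_single_zero]
    refine Submodule.smul_mem _ _ (ih ?_)
    rwa [← mul_smul, ← pow_succ]

theorem mem_xTorsion (hN : ∀ n : N, n ∈ xTorsion (φ ^ (k + 1)) (z : R) N)
    (f : InducedModule φ z k N) : f ∈ xTorsion φ (z : R) (InducedModule φ z k N) := by
  rw [← sum_single f]
  refine sum_mem fun i _ => ?_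
  rw [← y_pow_smul_single_zero]
  exact Submodule.smul_mem _ _ (single_zero_mem_xTorsion (hN _))

theorem single_zero_mem_zTorsion {n : N} (hn : n ∈ zTorsion (φ ^ (k + 1)) z N) :
    single φ z k N 0 n ∈ zTorsion φ z (InducedModule φ z k N) := by
  obtain ⟨t, ht⟩ := hn
  exact ⟨t, by rw [← map_pow, C_smul_single_zero, map_pow, ht, map_zero]⟩

theorem single_zero_apply_zero
    (hcop : ∀ i, 1 ≤ i → i ≤ k → IsCoprime z (Subring.centerCongr (φ ^ i) z))
    (hN : ∀ n : N, n ∈ zTorsion (φ ^ (k + 1)) z N) {f : InducedModule φ z k N}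
    (hf : f ∈ zTorsion φ z (InducedModule φ z k N)) : single φ z k N 0 (f 0) = f := by
  obtain ⟨t, ht⟩ := hf
  have htorsion (i : Fin (k + 1)) : GWA.ofCenter (φ ^ (k + 1)) (z : R)
      (Subring.centerCongr (φ ^ (i : ℕ))⁻¹ z ^ t) • f i = 0 := by
    rw [← map_pow]
    rw [← GWA.ofCenter_pow] at ht
    change action φ z k N (GWA.C φ (z : R) (z ^ t : Subring.center R)) f = 0 at ht
    rw [action_C] at ht
    exact congrFun ht i
  refine funext fun i => ?_
  change (Pi.single 0 (f 0) : Fin (k + 1) → N) i = f i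
  rcases eq_or_ne i 0 with rfl | hi
  · exact Pi.single_eq_same _ _
  · rw [Pi.single_eq_of_ne hi]
    symm
    obtain ⟨s, hs⟩ := hN (f i)
    exact eq_zero_of_isCoprime_of_smul_eq_zero (GWA.ofCenter (φ ^ (k + 1)) (z : R))
      (isCoprime_centerCongr_inv_pow hcop (Nat.one_le_iff_ne_zero.mpr (Fin.val_ne_zero_iff.mpr hi))
        i.is_le).pow (by rwa [GWA.ofCenter_pow]) (htorsion i)

end InducedModule

end Decomposition

namespace ExtendScalars

variable {A B N P : Type*} [Ring A] [Ring B] (f : A →+* B) [AddCommGroup N] [Module A N]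
  [AddCommGroup P] [Module B P]

/-- The map `N → B ⊗_A N`, `n ↦ 1 ⊗ n`. -/
def unit (N : Type*) [AddCommGroup N] [Module A N] : N →+ ExtendScalars f N where
  toFun n := Submodule.Quotient.mk (1 ⊗ₜ n)
  map_zero' := by rw [TensorProduct.tmul_zero, Submodule.Quotient.mk_zero]
  map_add' _ _ := by rw [TensorProduct.tmul_add, Submodule.Quotient.mk_add]

theorem smul_unit (b : B) (n : N) :
    b • unit f N n = (Submodule.Quotient.mk (b ⊗ₜ n) : ExtendScalars f N) := by
  change b • Submodule.Quotient.mk _ = _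
  rw [← Submodule.Quotient.mk_smul, TensorProduct.smul_tmul', smul_eq_mul, mul_one]

theorem unit_smul (a : A) (n : N) : unit f N (a • n) = f a • unit f N n := by
  rw [smul_unit]
  refine ((Submodule.Quotient.eq _).mpr (Submodule.subset_span ?_)).symm
  exact ⟨1, a, n, by rw [one_mul]⟩

theorem induction {p : ExtendScalars f N → Prop} (hunit : ∀ (b : B) n, p (b • unit f N n))
    (hadd : ∀ s t, p s → p t → p (s + t)) (t : ExtendScalars f N) : p t := by
  obtain ⟨t, rfl⟩ := Submodule.Quotient.mk_surjective _ t
  induction t with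
  | zero =>
    have h := hunit 0 0
    rwa [zero_smul] at h
  | tmul b n => exact smul_unit f b n ▸ hunit b n
  | add s t hs ht => exact hadd _ _ hs ht

variable {f}

/-- The universal property of `B ⊗_A N`. -/
def lift (ι : N →+ P) (hι : ∀ (a : A) n, ι (a • n) = f a • ι n) : ExtendScalars f N →ₗ[B] P :=
  Submodule.liftQ _ (TensorProduct.AlgebraTensorModule.lift
    (LinearMap.toSpanSingleton B (N →ₗ[ℤ] P) ι.toIntLinearMap)) (by
      rw [Submodule.span_le]
      rintro _ ⟨b, a, n, rfl⟩
      change _ = _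
      rw [map_sub, TensorProduct.AlgebraTensorModule.lift_tmul,
        TensorProduct.AlgebraTensorModule.lift_tmul, sub_eq_zero]
      change (b * f a) • ι n = b • ι (a • n)
      rw [hι, mul_smul])

theorem lift_unit (ι : N →+ P) (hι : ∀ (a : A) n, ι (a • n) = f a • ι n) (n : N) :
    lift ι hι (unit f N n) = ι n := by
  change (1 : B) • ι n = ι n
  rw [one_smul]

end ExtendScalars

namespace TwistedPoly

variable {R : Type u} [Ring R]

theorem induction {φ : RingAut R} {p : TwistedPoly φ → Prop} (hC : ∀ r, p (C φ r)) (hy : p (y φ))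
    (hadd : ∀ a b, p a → p b → p (a + b)) (hmul : ∀ a b, p a → p b → p (a * b))
    (a : TwistedPoly φ) : p a := by
  have hpow (n : ℕ) : p (y φ ^ n) := by
    induction n with
    | zero => exact pow_zero (y φ) ▸ map_one (C φ) ▸ hC 1
    | succ n ih => exact pow_succ (y φ) n ▸ hmul _ _ ih hy
  induction a using SkewPolynomial.induction with
  | h0 => exact map_zero (C φ) ▸ hC 0
  | ha n r q _ _ hq =>
    rw [← SkewPolynomial.C_mul_X_pow_eq_monomial]
    exact hadd _ _ (hmul _ _ (hC r) (hpow n)) hq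

theorem C_mul_y_pow (φ : RingAut R) (n : ℕ) (r : R) :
    C φ r * y φ ^ n = y φ ^ n * C φ ((φ ^ n)⁻¹ r) := by
  rw [y_pow_mul_C]
  exact congrArg (C φ · * _) ((φ ^ n).apply_symm_apply r).symm

theorem frobenius_C (φ : RingAut R) (l : ℕ) (r : R) : frobenius φ l (C (φ ^ l) r) = C φ r :=
  lift_C ..

theorem frobenius_y (φ : RingAut R) (l : ℕ) : frobenius φ l (y (φ ^ l)) = y φ ^ l :=
  lift_y ..

theorem toGWA_C (φ : RingAut R) (z r : R) : toGWA φ z (C φ r) = GWA.C φ z r :=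
  lift_C ..

theorem toGWA_y (φ : RingAut R) (z : R) : toGWA φ z (y φ) = GWA.y φ z :=
  lift_y ..

section Frobenius

variable {φ : RingAut R} {k : ℕ} {N P : Type*} [AddCommGroup N]
  [Module (TwistedPoly (φ ^ (k + 1))) N] [AddCommGroup P] [Module (TwistedPoly φ) P]

theorem smul_mem_range_powSum {ι : N →+ P}
    (hι : ∀ (a : TwistedPoly (φ ^ (k + 1))) n, ι (a • n) = frobenius φ (k + 1) a • ι n)
    (a : TwistedPoly φ) {p : P} (hp : p ∈ (powSum (y φ) (k + 1) ι).range) :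
    a • p ∈ (powSum (y φ) (k + 1) ι).range := by
  induction a using induction generalizing p with
  | hC r =>
    obtain ⟨f, rfl⟩ := hp
    refine ⟨fun i => C (φ ^ (k + 1)) ((φ ^ (i : ℕ))⁻¹ r) • f i, ?_⟩
    simp only [powSum_apply, hι, frobenius_C, Finset.smul_sum, ← mul_smul, C_mul_y_pow]
  | hy =>
    obtain ⟨f, rfl⟩ := hp
    exact ⟨_, (smul_powSum_eq_powSum_cons (n := y (φ ^ (k + 1)) • f (Fin.last k))
      (by rw [hι, frobenius_y])).symm⟩
  | hadd a b ha hb => exact add_smul a b p ▸ add_mem (ha hp) (hb hp)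
  | hmul a b ha hb => exact mul_smul a b p ▸ ha (hb hp)

theorem powSum_unit_surjective : Function.Surjective
    (powSum (y φ) (k + 1) (ExtendScalars.unit (frobenius φ (k + 1)) N)) := by
  intro t
  rw [← AddMonoidHom.mem_range]
  induction t using ExtendScalars.induction with
  | hunit b n =>
    refine smul_mem_range_powSum (ExtendScalars.unit_smul _) b ⟨Pi.single 0 n, ?_⟩
    rw [powSum_single, Fin.val_zero, pow_zero, one_smul]
  | hadd s t hs ht => exact add_mem hs ht

theorem lift_bijective_of_powSum_bijective {ι : N →+ P}
    (hι : ∀ (a : TwistedPoly (φ ^ (k + 1))) n, ι (a • n) = frobenius φ (k + 1) a • ι n)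
    (hbij : Function.Bijective (powSum (y φ) (k + 1) ι)) :
    Function.Bijective (ExtendScalars.lift ι hι) := by
  have hcomp : ExtendScalars.lift ι hι ∘
      powSum (y φ) (k + 1) (ExtendScalars.unit (frobenius φ (k + 1)) N) =
        powSum (y φ) (k + 1) ι := by
    funext f
    simp only [Function.comp_apply, powSum_apply, map_sum, map_smul, ExtendScalars.lift_unit]
  rw [← hcomp] at hbij
  exact (Function.Bijective.of_comp_iff _
    ⟨hbij.injective.of_comp, powSum_unit_surjective⟩).mp hbij

end Frobenius

end TwistedPoly

theorem IsFrobeniusLinear.map_toGWA_smul {R : Type u} [Ring R] {φ : RingAut R}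
    {z : Subring.center R} {k : ℕ} {N M : Type*} [AddCommGroup N]
    [Module (GWA (φ ^ (k + 1)) (z : R)) N] [AddCommGroup M] [Module (GWA φ (z : R)) M] {ι : N →+ M}
    (h : IsFrobeniusLinear φ z k ι) (a : TwistedPoly (φ ^ (k + 1))) (n : N) :
    ι (TwistedPoly.toGWA (φ ^ (k + 1)) (z : R) a • n) =
      TwistedPoly.toGWA φ (z : R) (TwistedPoly.frobenius φ (k + 1) a) • ι n := by
  induction a using TwistedPoly.induction generalizing n with
  | hC r => rw [TwistedPoly.frobenius_C, TwistedPoly.toGWA_C, TwistedPoly.toGWA_C, h.map_C]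
  | hy =>
    rw [TwistedPoly.frobenius_y, TwistedPoly.toGWA_y, map_pow, TwistedPoly.toGWA_y, h.map_y]
  | hadd a b ha hb => simp only [map_add, add_smul, ha, hb]
  | hmul a b ha hb => simp only [map_mul, mul_smul, ha, hb]

section Equivalence

variable {R : Type u} [Ring R] {φ : RingAut R} {z : Subring.center R}

section

variable {k : ℕ} (hl : 1 ≤ k + 1) (hnil : IsNilpotent (Subring.centerCongr (φ ^ (k + 1)) z - z))
  (hcop : ∀ i, 1 ≤ i → i ≤ k + 1 - 1 → Ideal.span {z, Subring.centerCongr (φ ^ i) z} = ⊤)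

/-- The inclusion of `F(M) = M^{z^∞}` in `M`, a map of the underlying groups only: `F(M)` and `M`
are modules over different rings. -/
def torsionInclusion (M : CategoryO.{u, v} φ (z : R)) :
    ((torsionFunctor.{u, v} φ z (k + 1) hl hnil hcop).obj M).obj →+ M.obj :=
  (zTorsion φ z M.obj).subtype

theorem isFrobeniusLinear_torsionInclusion (M : CategoryO.{u, v} φ (z : R)) :
    IsFrobeniusLinear φ z k (torsionInclusion hl hnil hcop M) :=
  zTorsion.isFrobeniusLinear_subtype hl hnil _

theorem powSum_torsionInclusion_bijective (M : CategoryO.{u, v} φ (z : R)) :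
    Function.Bijective (powSum (GWA.y φ (z : R)) (k + 1) (torsionInclusion hl hnil hcop M)) :=
  have hcop' i h1 hi := isCoprime_of_span_pair_eq_top (hcop i h1 hi)
  ⟨zTorsion.powSum_subtype_injective hcop',
    fun m => zTorsion.exists_powSum_subtype_eq hcop' hnil (M.property m)⟩

theorem torsionFunctor_faithful : (torsionFunctor.{u, v} φ z (k + 1) hl hnil hcop).Faithful where
  map_injective {M M'} f g hfg := by
    have hι (n) : f.hom.hom (torsionInclusion hl hnil hcop M n) =
        g.hom.hom (torsionInclusion hl hnil hcop M n) :=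
      congrArg Subtype.val (congrArg (fun t => t.hom.hom n) hfg)
    refine ObjectProperty.hom_ext _ (ModuleCat.hom_ext (LinearMap.ext fun m => ?_))
    obtain ⟨t, rfl⟩ := (powSum_torsionInclusion_bijective hl hnil hcop M).2 m
    simp only [powSum_apply, map_sum, map_smul, hι]

theorem torsionFunctor_full : (torsionFunctor.{u, v} φ z (k + 1) hl hnil hcop).Full where
  map_surjective {M M'} g := by
    have hι := isFrobeniusLinear_torsionInclusion hl hnil hcop M
    have hg := (isFrobeniusLinear_torsionInclusion hl hnil hcop M').comp g.hom.hom
    let e := LinearEquiv.ofBijective hι.lift (powSum_torsionInclusion_bijective hl hnil hcop M)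
    refine ⟨ObjectProperty.homMk (ModuleCat.ofHom (hg.lift ∘ₗ e.symm.toLinearMap)), ?_⟩
    refine ObjectProperty.hom_ext _ (ModuleCat.hom_ext (LinearMap.ext fun n => Subtype.ext ?_))
    change hg.lift (e.symm (torsionInclusion hl hnil hcop M n)) =
      torsionInclusion hl hnil hcop M' (g.hom.hom n)
    have he : e (InducedModule.single φ z k _ 0 n) = torsionInclusion hl hnil hcop M n :=
      hι.lift_single_zero n
    rw [← he, LinearEquiv.symm_apply_apply, hg.lift_single_zero]
    rfl

theorem torsionFunctor_essSurj : (torsionFunctor.{u, v} φ z (k + 1) hl hnil hcop).EssSurj where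
  mem_essImage N := by
    have hcop' i h1 hi := isCoprime_of_span_pair_eq_top (hcop i h1 hi)
    have hN (n : N.obj) : n ∈ zTorsion (φ ^ (k + 1)) z N.obj :=
      zTorsion.mem_of_mem_xTorsion hnil (N.property n)
    let M : CategoryO.{u, v} φ (z : R) :=
      { obj := ModuleCat.of (GWA φ (z : R)) (InducedModule φ z k N.obj)
        property := InducedModule.mem_xTorsion N.property }
    let g : N.obj →+ ((torsionFunctor.{u, v} φ z (k + 1) hl hnil hcop).obj M).obj :=
      (InducedModule.single φ z k N.obj 0).codRestrict (zTorsion φ z M.obj)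
        fun n => InducedModule.single_zero_mem_zTorsion (hN n)
    have hg : Function.Bijective g :=
      ⟨fun a b hab => InducedModule.single_injective 0 (congrArg Subtype.val hab), fun m =>
        ⟨_, Subtype.ext (InducedModule.single_zero_apply_zero hcop' hN m.2)⟩⟩
    have hlinear := (isFrobeniusLinear_torsionInclusion hl hnil hcop M).map_smul_of_comp (g := g)
      IsFrobeniusLinear.single_zero fun n hn =>
        Subtype.ext (zTorsion.eq_zero_of_y_pow_smul_eq_zero hcop' le_rfl n.2 hn)
    let e := (AddEquiv.ofBijective g hg).toLinearEquiv hlinear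
    exact ⟨M, ⟨ObjectProperty.isoMk _ e.toModuleIso.symm⟩⟩

end

variable {l : ℕ} (hl : 1 ≤ l) (hnil : IsNilpotent (Subring.centerCongr (φ ^ l) z - z))
  (hcop : ∀ i, 1 ≤ i → i ≤ l - 1 → Ideal.span {z, Subring.centerCongr (φ ^ i) z} = ⊤)

theorem torsionFunctor_isEquivalence :
    (torsionFunctor.{u, v} φ z l hl hnil hcop).IsEquivalence := by
  obtain ⟨k, rfl⟩ := Nat.exists_eq_add_of_le' hl
  exact
    { faithful := torsionFunctor_faithful hl hnil hcop
      full := torsionFunctor_full hl hnil hcop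
      essSurj := torsionFunctor_essSurj hl hnil hcop }

theorem nonempty_linearEquiv_extendScalars_torsionFunctor_obj (M : CategoryO.{u, v} φ (z : R)) :
    Nonempty ((ModuleCat.restrictScalars (TwistedPoly.toGWA φ (z : R))).obj M.obj
      ≃ₗ[TwistedPoly φ]
      ExtendScalars (TwistedPoly.frobenius φ l)
        ((ModuleCat.restrictScalars (TwistedPoly.toGWA (φ ^ l) (z : R))).obj
          ((torsionFunctor.{u, v} φ z l hl hnil hcop).obj M).obj)) := by
  obtain ⟨k, rfl⟩ := Nat.exists_eq_add_of_le' hl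
  let ι : (ModuleCat.restrictScalars (TwistedPoly.toGWA (φ ^ (k + 1)) (z : R))).obj
      ((torsionFunctor.{u, v} φ z (k + 1) hl hnil hcop).obj M).obj →+
        (ModuleCat.restrictScalars (TwistedPoly.toGWA φ (z : R))).obj M.obj :=
    torsionInclusion hl hnil hcop M
  have hpow : powSum (TwistedPoly.y φ) (k + 1) ι =
      powSum (GWA.y φ (z : R)) (k + 1) (torsionInclusion hl hnil hcop M) := by
    refine AddMonoidHom.ext fun f => (powSum_apply ..).trans ?_
    refine Eq.trans (Finset.sum_congr rfl fun i _ => ?_)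
      (powSum_apply (M := M.obj) (GWA.y φ (z : R)) _ (torsionInclusion hl hnil hcop M) f).symm
    rw [← TwistedPoly.toGWA_y, ← map_pow]
    rfl
  exact ⟨(LinearEquiv.ofBijective _ (TwistedPoly.lift_bijective_of_powSum_bijective
    (isFrobeniusLinear_torsionInclusion hl hnil hcop M).map_toGWA_smul
    (hpow ▸ powSum_torsionInclusion_bijective hl hnil hcop M))).symm⟩

end Equivalence

end

theorem mainTheorem1 {R : Type u} [Ring R] (φ : RingAut R) (z b : Subring.center R) (l : ℕ)
    (hl : 1 ≤ l) (hb : IsNilpotent b) (hz : (b : R) ∣ (φ ^ l) (z : R) - z)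
    (hcop : ∀ i, 1 ≤ i → i ≤ l - 1 → Ideal.span {z, Subring.centerCongr (φ ^ i) z} = ⊤) :
    (torsionFunctor.{u, v} φ z l hl (isNilpotent_of_dvd φ z l hb hz) hcop).IsEquivalence ∧
    ∀ M : CategoryO.{u, v} φ (z : R), ∃ N : CategoryO.{u, v} (φ ^ l) (z : R),
      Nonempty ((ModuleCat.restrictScalars (TwistedPoly.toGWA φ (z : R))).obj M.obj
        ≃ₗ[TwistedPoly φ]
        ExtendScalars (TwistedPoly.frobenius φ l)
          ((ModuleCat.restrictScalars (TwistedPoly.toGWA (φ ^ l) (z : R))).obj N.obj)) := by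
  have hnil := isNilpotent_of_dvd φ z l hb hz
  exact ⟨torsionFunctor_isEquivalence hl hnil hcop,
    fun M => ⟨_, nonempty_linearEquiv_extendScalars_torsionFunctor_obj hl hnil hcop M⟩⟩
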